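/- Let $Y$ be an $n$-dimensional toric Fano manifold, given by a smooth complete fan in a lattice $N\cong\mathbb{Z}^n$ with ray generators $v_1,\dots,v_R$, and let $D_j\in\operatorname{Pic}(Y)$ be the class of the torus-invariant prime divisor of the $j$-th ray. Let $L_1,\dots,L_c\in\operatorname{Pic}(Y)$ be nef classes such that $-K_Y-L_1-\cdots-L_c$ is ample, and let $X\subset Y$ be a complete intersection defined by sections of $L_1,\dots,L_c$. A *nef partition* of $(Y;L_1,\dots,L_c)$ is a partition of $\{1,\dots,R\}$ into sets $S_1,\dots,S_{c+1}$ with $L_i=\sum_{j\in S_i}D_j$ for $1\le i\le c$. Given a nef partition, choose elements $s_i\in S_i$ for $1\le i\le c$ and a subset $E\subset S_{c+1}$ such that $\{D_b: b\in E\}$ is a basis of $\operatorname{Pic}(Y)$ and every $L_i$ is a non-negative linear combination of $\{D_b: b\in E\}$. The *Przyjalkowski method* associates to these choices the following Laurent polynomial $f$ in the variables $y_j$, $j\notin E\cup\{s_1,\dots,s_c\}$, called a Laurent polynomial mirror to $X$. Put $y_{s_i}=1$ for $1\le i\le c$. Set $x_j=y_j/\sum_{k\in S_i}y_k$ for $j\in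 S_i$, $1\le i\le c$; set $x_j=y_j$ for $j\in S_{c+1}\setminus E$; and let $x_b$, $b\in E$, be the rational functions determined by requiring $\prod_{j=1}^R x_j^{l_j}=1$ for all $l\in\mathbb{Z}^R$ with $\sum_j l_jv_j=0$. Then $f=x_1+\cdots+x_R$. Laurent polynomials $f$ and $g$ on tori with coordinates $z_1,\dots,z_m$ and $z_1',\dots,z_m'$ are *mutation equivalent* if there is a birational map $\varphi$ from the torus of $g$ to the torus of $f$ with $\varphi^\star f=g$ that is volume preserving, i.e. $\varphi^\star\big(\bigwedge_i d\log z_i\big)=\pm\bigwedge_i d\log z'_i$ (the form of a torus depends on the order of its coordinates and so is defined up to sign). **Corollary.** Let $f$ and $g$ be Laurent polynomial mirrors to $X$ obtained by the Przyjalkowski method from two nef partitions of the same $(Y;L_1,\dots,L_c)$, each with its own choice of elements $s_i\in S_i$ and subset $E\subset S_{c+1}$ as above. Then $f$ and $g$ are mutation equivalent. -/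

import Mathlib

noncomputable section

/-! ### Toric manifolds, their Picard groups, nef and ample classes -/

/-- A smooth complete fan in `N = ℤⁿ` with `R` rays, i.e. a smooth complete toric variety `Y` of
dimension `n`.  The `j`-th ray is generated by `ray j`, and a maximal cone is recorded by the set of
its rays. -/
structure SmoothCompleteFan (n R : ℕ) where
  /-- the ray generators `v_1, …, v_R` -/
  ray : Fin R → (Fin n → ℤ)
  /-- the maximal cones -/
  maxCones : Set (Finset (Fin R))
  /-- every ray belongs to the fan -/
  exists_mem : ∀ j, ∃ σ ∈ maxCones, j ∈ σ
  /-- smoothness: the rays of a maximal cone form a `ℤ`-basis of `N` -/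
  linearIndependent : ∀ σ ∈ maxCones, LinearIndependent ℤ (fun j : σ => ray j)
  span_eq_top : ∀ σ ∈ maxCones, Submodule.span ℤ (Set.range fun j : σ => ray j) = ⊤
  /-- two maximal cones meet in the common face spanned by their common rays -/
  inter_eq : ∀ σ ∈ maxCones, ∀ τ ∈ maxCones,
    (PointedCone.hull ℝ ((fun j k => (ray j k : ℝ)) '' (σ : Set (Fin R))) : Set (Fin n → ℝ)) ∩
      PointedCone.hull ℝ ((fun j k => (ray j k : ℝ)) '' (τ : Set (Fin R))) =
    PointedCone.hull ℝ ((fun j k => (ray j k : ℝ)) '' ((σ : Set (Fin R)) ∩ τ))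
  /-- completeness: the cones cover `N ⊗ ℝ` -/
  complete : ∀ x : Fin n → ℝ, ∃ σ ∈ maxCones,
    x ∈ PointedCone.hull ℝ ((fun j k => (ray j k : ℝ)) '' (σ : Set (Fin R)))

namespace SmoothCompleteFan

variable {n R : ℕ} (Y : SmoothCompleteFan n R)

/-- The map `ρ^⋆ : M → (ℤ^R)^⋆`, `m ↦ (⟨m, v_j⟩)_j`, where `M` is the dual lattice of `N`. -/
def rhoDual : Module.Dual ℤ (Fin n → ℤ) →ₗ[ℤ] (Fin R → ℤ) :=
  LinearMap.pi fun j => Module.Dual.eval ℤ (Fin n → ℤ) (Y.ray j)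

/-- `Pic(Y)`, the cokernel of `ρ^⋆`: torus-invariant divisors modulo divisors of characters. -/
abbrev Pic : Type := (Fin R → ℤ) ⧸ LinearMap.range Y.rhoDual

/-- The class of the torus-invariant divisor with coefficients `a`. -/
def divClass : (Fin R → ℤ) →ₗ[ℤ] Y.Pic := (LinearMap.range Y.rhoDual).mkQ

/-- The class `D_j` of the torus-invariant prime divisor of the `j`-th ray. -/
def D (j : Fin R) : Y.Pic := Y.divClass (Pi.single j 1)

/-- The anticanonical class `-K_Y`. -/
def antiK : Y.Pic := ∑ j, Y.D j

/-- A class is nef if the support function of a torus-invariant divisor `∑ a_j D_j` representing it,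
given by `m` on the maximal cone `σ`, is convex. -/
def IsNef (L : Y.Pic) : Prop :=
  ∃ a : Fin R → ℤ, Y.divClass a = L ∧ ∀ σ ∈ Y.maxCones, ∃ m : Module.Dual ℤ (Fin n → ℤ),
    (∀ j ∈ σ, m (Y.ray j) = -a j) ∧ ∀ j, -a j ≤ m (Y.ray j)

/-- A class is ample if the support function of a torus-invariant divisor `∑ a_j D_j` representing
it, given by `m` on the maximal cone `σ`, is strictly convex. -/
def IsAmple (L : Y.Pic) : Prop :=
  ∃ a : Fin R → ℤ, Y.divClass a = L ∧ ∀ σ ∈ Y.maxCones, ∃ m : Module.Dual ℤ (Fin n → ℤ),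
    (∀ j ∈ σ, m (Y.ray j) = -a j) ∧ ∀ j ∉ σ, -a j < m (Y.ray j)

end SmoothCompleteFan

/-! ### Laurent polynomials, rational functions, mutation equivalence -/

/-- The ring of complex Laurent polynomials in variables indexed by `J`, that is, the coordinate
ring of the torus `(ℂ^⋆)^J`. -/
abbrev LaurentRing (J : Type) : Type := AddMonoidAlgebra ℂ (J →₀ ℤ)

/-- The field of rational functions on the torus `(ℂ^⋆)^J`. -/
abbrev TorusFunctionField (J : Type) : Type := FractionRing (LaurentRing J)

/-- The `j`-th coordinate of the torus, as a rational function. -/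
def torusCoord {J : Type} (j : J) : TorusFunctionField J :=
  algebraMap (LaurentRing J) (TorusFunctionField J)
    (AddMonoidAlgebra.single (Finsupp.single j 1) 1)

/-- The logarithmic form `d log x_1 ∧ ⋯ ∧ d log x_m` of rational functions on a torus. -/
def logForm {J : Type} {m : ℕ} (x : Fin m → TorusFunctionField J) :
    ⋀[TorusFunctionField J]^m (Ω[TorusFunctionField J⁄ℂ]) :=
  exteriorPower.ιMulti (TorusFunctionField J) m
    fun i => (x i)⁻¹ • KaehlerDifferential.D ℂ (TorusFunctionField J) (x i)

/-- A birational map `(ℂ^⋆)^{J'} ⇢ (ℂ^⋆)^J`, given by its pull-back `φ` of rational functions, is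
volume preserving if the pull-back of `∧ d log z_j`, which is `∧ d log (φ z_j)`, is
`∧ d log z'_j`.  The form of a torus depends on the order of the coordinates, so it is defined up
to sign only, and the equality is up to sign. -/
def IsVolumePreserving {J J' : Type}
    (φ : TorusFunctionField J ≃ₐ[ℂ] TorusFunctionField J') : Prop :=
  ∃ (m : ℕ) (e : Fin m ≃ J) (e' : Fin m ≃ J'),
    logForm (fun i => φ (torusCoord (e i))) = logForm (fun i => torusCoord (e' i)) ∨
    logForm (fun i => φ (torusCoord (e i))) = -logForm (fun i => torusCoord (e' i))

/-- Laurent polynomials `f` and `g` are mutation equivalent if `φ^⋆ f = g` for a volume preserving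
birational map `φ` of tori; birational maps are isomorphisms of function fields over `ℂ`. -/
def MutationEquivalent {J J' : Type} (f : LaurentRing J) (g : LaurentRing J') : Prop :=
  ∃ φ : TorusFunctionField J ≃ₐ[ℂ] TorusFunctionField J',
    IsVolumePreserving φ ∧
    φ (algebraMap (LaurentRing J) (TorusFunctionField J) f) =
      algebraMap (LaurentRing J') (TorusFunctionField J') g

/-! ### Nef partitions and the Przyjalkowski method -/

/-- A nef partition of `(Y; L_1, …, L_c)`: a partition of the rays into `c + 1` sets such that
`L_i = ∑_{j ∈ S_i} D_j` for the first `c` of them. -/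
structure NefPartition {n R c : ℕ} (Y : SmoothCompleteFan n R) (L : Fin c → Y.Pic) where
  S : Fin (c + 1) → Finset (Fin R)
  existsUnique_mem : ∀ j, ∃! i, j ∈ S i
  sum_eq : ∀ i : Fin c, ∑ j ∈ S i.castSucc, Y.D j = L i

/-- The choices of the Przyjalkowski method for a nef partition: elements `s_i ∈ S_i` for `i ≤ c`,
and a subset `E` of `S_{c+1}` whose divisors form a basis of `Pic(Y)` in which every `L_i` has
non-negative coefficients. -/
structure PrzyjalkowskiChoice {n R c : ℕ} {Y : SmoothCompleteFan n R} {L : Fin c → Y.Pic}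
    (P : NefPartition Y L) where
  s : Fin c → Fin R
  s_mem : ∀ i, s i ∈ P.S i.castSucc
  E : Finset (Fin R)
  E_subset : E ⊆ P.S (Fin.last c)
  linearIndependent : LinearIndependent ℤ (fun b : E => Y.D b)
  span_eq_top : Submodule.span ℤ (Set.range fun b : E => Y.D b) = ⊤
  nonneg : ∀ i, ∃ a : Fin R → ℕ, L i = ∑ b ∈ E, a b • Y.D b

namespace PrzyjalkowskiChoice

variable {n R c : ℕ} {Y : SmoothCompleteFan n R} {L : Fin c → Y.Pic} {P : NefPartition Y L}
  (d : PrzyjalkowskiChoice P)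

/-- The index set of the variables of the Laurent polynomial: all rays except the `s_i` and those
of `E`. -/
abbrev Var : Type := {j : Fin R // j ∉ d.E ∧ ∀ i, j ≠ d.s i}

/-- The variable `y_j` of a ray `j ∉ E`, where `y_j = 1` for `j = s_i`
(the value at `j ∈ E` is never used). -/
def y (j : Fin R) : TorusFunctionField d.Var :=
  open Classical in if h : j ∉ d.E ∧ ∀ i, j ≠ d.s i then torusCoord (J := d.Var) ⟨j, h⟩ else 1

/-- The substitution of the Przyjalkowski method.  The torus `Spec ℂ[N]`, on which the potential
`W = z^{v_1} + ⋯ + z^{v_R}` lives, has coordinates `x_j = z^{v_j}` subject to the monomial relations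
given by the linear relations among the `v_j`.  The equations `∑_{j ∈ S_i} x_j = 1` are solved by
`x_j = y_j / ∑_{k ∈ S_i} y_k`; the `x_j` with `j ∈ S_{c+1} \ E` are free variables; and the `x_b`
with `b ∈ E` are eliminated by means of the relations. -/
structure IsSubstitution (x : Fin R → TorusFunctionField d.Var) : Prop where
  ne_zero : ∀ j, x j ≠ 0
  relation : ∀ l : Fin R → ℤ, ∑ j, l j • Y.ray j = 0 → ∏ j, x j ^ l j = 1
  block : ∀ i : Fin c, ∀ j ∈ P.S i.castSucc, x j = d.y j / ∑ k ∈ P.S i.castSucc, d.y k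
  free : ∀ j ∈ P.S (Fin.last c), j ∉ d.E → x j = d.y j

/-- `f` is the Laurent polynomial formed by the Przyjalkowski method: as a rational function on its
torus it is the potential `W = x_1 + ⋯ + x_R` after the substitution. -/
def IsMirror (f : LaurentRing d.Var) : Prop :=
  ∃ x, d.IsSubstitution x ∧
    algebraMap (LaurentRing d.Var) (TorusFunctionField d.Var) f = ∑ j, x j

/-! The next facts check that the Przyjalkowski method produces a Laurent polynomial. -/

theorem y_zpow_mem (j : Fin R) (z : ℤ) :
    d.y j ^ z ∈ (algebraMap (LaurentRing d.Var) (TorusFunctionField d.Var)).range := by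
  unfold y
  split_ifs with h
  · set J := d.Var
    have hinv : (torusCoord (J := J) ⟨j, h⟩)⁻¹ =
        algebraMap (LaurentRing J) (TorusFunctionField J)
          (AddMonoidAlgebra.single (Finsupp.single ⟨j, h⟩ (-1)) 1) := by
      refine inv_eq_of_mul_eq_one_right ?_
      rw [torusCoord, ← map_mul, AddMonoidAlgebra.single_mul_single, ← Finsupp.single_add]
      simp [← AddMonoidAlgebra.one_def]
    obtain ⟨k, rfl | rfl⟩ := z.eq_nat_or_neg
    · rw [zpow_natCast]
      exact pow_mem (RingHom.mem_range_self _ _) k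
    · rw [zpow_neg, zpow_natCast, ← inv_pow, hinv]
      exact pow_mem (RingHom.mem_range_self _ _) k
  · rw [one_zpow]
    exact one_mem _

theorem y_ne_zero (j : Fin R) : d.y j ≠ 0 := by
  unfold y
  split_ifs with h
  · rw [torusCoord]
    refine (map_ne_zero_iff _ (IsFractionRing.injective _ _)).2 ?_
    simp [AddMonoidAlgebra.single_eq_zero]
  · exact one_ne_zero

theorem sum_y_ne_zero (T : Finset (Fin R)) (hT : T.Nonempty) : ∑ k ∈ T, d.y k ≠ 0 := by
  classical
  set J := d.Var
  let y' : Fin R → LaurentRing J := fun j =>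
    if h : j ∉ d.E ∧ ∀ i, j ≠ d.s i then AddMonoidAlgebra.single (Finsupp.single ⟨j, h⟩ 1) 1 else 1
  have hy : ∀ j, d.y j = algebraMap (LaurentRing J) (TorusFunctionField J) (y' j) := by
    intro j
    simp only [y, y']
    split_ifs
    · rfl
    · simp
  let ε : LaurentRing J →ₐ[ℂ] ℂ := AddMonoidAlgebra.lift ℂ ℂ (J →₀ ℤ) 1
  have hε : ∀ j, ε (y' j) = 1 := by
    intro j
    simp only [y', ε]
    split_ifs
    · simp
    · simp
  simp_rw [hy]
  rw [← map_sum]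
  refine (map_ne_zero_iff _ (IsFractionRing.injective _ _)).2 ?_
  intro h0
  have h1 := congrArg ε h0
  simp only [map_sum, hε, map_zero, Finset.sum_const, nsmul_eq_mul, mul_one, Nat.cast_eq_zero,
    Finset.card_eq_zero] at h1
  exact hT.ne_empty h1

theorem exists_isMirror : ∃ f, d.IsMirror f := by
  classical
  set K := TorusFunctionField d.Var
  set A := (algebraMap (LaurentRing d.Var) (TorusFunctionField d.Var)).range
  let B : Module.Basis d.E ℤ Y.Pic := Module.Basis.mk d.linearIndependent d.span_eq_top.ge
  let q : Fin R → Fin R → ℤ := fun k b => if h : b ∈ d.E then B.repr (Y.D k) ⟨b, h⟩ else 0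
  choose blk hblk using fun j => (P.existsUnique_mem j).exists
  have hblk' : ∀ j i, j ∈ P.S i ↔ blk j = i := fun j i =>
    ⟨fun h => (P.existsUnique_mem j).unique (hblk j) h, fun h => h ▸ hblk j⟩
  let den : Fin (c + 1) → K :=
    Fin.lastCases 1 (fun i => ∑ k ∈ P.S i.castSucc, d.y k)
  have hdenl : den (Fin.last c) = 1 := by simp [den]
  have hdenc : ∀ i : Fin c, den i.castSucc = ∑ k ∈ P.S i.castSucc, d.y k := by
    intro i; simp [den]
  have hden0 : ∀ i, den i ≠ 0 := by
    intro i
    induction i using Fin.lastCases with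
    | last => rw [hdenl]; exact one_ne_zero
    | cast i => rw [hdenc]; exact d.sum_y_ne_zero _ ⟨_, d.s_mem i⟩
  let x0 : Fin R → K := fun j => d.y j / den (blk j)
  have hx0 : ∀ j, x0 j ≠ 0 := fun j => div_ne_zero (d.y_ne_zero j) (hden0 _)
  let x : Fin R → K := fun j =>
    if j ∈ d.E then ∏ k ∈ d.Eᶜ, x0 k ^ (-q k j) else x0 j
  have hxE : ∀ j ∈ d.E, x j = ∏ k ∈ d.Eᶜ, x0 k ^ (-q k j) := fun j hj => if_pos hj
  have hxn : ∀ j ∉ d.E, x j = x0 j := fun j hj => if_neg hj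
  have hEl : ∀ b ∈ d.E, blk b = Fin.last c := fun b hb => (hblk' _ _).1 (d.E_subset hb)
  have hSE : ∀ (i : Fin c), ∀ j ∈ P.S i.castSucc, j ∉ d.E := by
    intro i j hj hE
    have := hEl j hE
    rw [(hblk' _ _).1 hj] at this
    exact (Fin.castSucc_lt_last i).ne this
  have hblock : ∀ i : Fin c, ∀ j ∈ P.S i.castSucc,
      x j = d.y j / ∑ k ∈ P.S i.castSucc, d.y k := by
    intro i j hj
    rw [hxn j (hSE i j hj), ← hdenc, ← (hblk' _ _).1 hj]
  have hfree : ∀ j ∈ P.S (Fin.last c), j ∉ d.E → x j = d.y j := by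
    intro j hj hE
    simp only [hxn j hE, x0, (hblk' _ _).1 hj, hdenl, div_one]
  have hrepr : ∀ (v : Y.Pic) (μ : Y.Pic →ₗ[ℤ] ℤ),
      μ v = ∑ b : d.E, B.repr v b * μ (Y.D b) := by
    intro v μ
    conv_lhs => rw [← B.sum_repr v]
    simp [B]
  have hrel : ∀ l : Fin R → ℤ, ∑ j, l j • Y.ray j = 0 →
      ∀ k, l k = ∑ b ∈ d.E, q k b * l b := by
    intro l hl k
    let μ0 : (Fin R → ℤ) →ₗ[ℤ] ℤ := ∑ j, l j • LinearMap.proj j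
    have hμ0 : LinearMap.range Y.rhoDual ≤ LinearMap.ker μ0 := by
      rintro _ ⟨m, rfl⟩
      have h2 := congrArg m hl
      simp only [map_sum, map_smul, map_zero] at h2
      simpa [μ0, SmoothCompleteFan.rhoDual] using h2
    let μ : Y.Pic →ₗ[ℤ] ℤ := (LinearMap.range Y.rhoDual).liftQ μ0 hμ0
    have hμ : ∀ j, μ (Y.D j) = l j := by
      intro j
      have : μ (Y.D j) = μ0 (Pi.single j 1) := rfl
      rw [this]
      simp [μ0, Pi.single_apply]
    rw [← hμ k, hrepr, ← Finset.sum_coe_sort d.E]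
    refine Finset.sum_congr rfl fun b _ => ?_
    simp [q, hμ]
  have hrelx : ∀ l : Fin R → ℤ, ∑ j, l j • Y.ray j = 0 → ∏ j, x j ^ l j = 1 := by
    intro l hl
    rw [← Finset.prod_mul_prod_compl d.E]
    have h1 : ∏ j ∈ d.E, x j ^ l j = ∏ k ∈ d.Eᶜ, x0 k ^ (-l k) := by
      calc ∏ j ∈ d.E, x j ^ l j = ∏ j ∈ d.E, ∏ k ∈ d.Eᶜ, x0 k ^ (-q k j * l j) := by
            refine Finset.prod_congr rfl fun j hj => ?_
            rw [hxE j hj, ← Finset.prod_zpow]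
            simp_rw [zpow_mul]
        _ = ∏ k ∈ d.Eᶜ, ∏ j ∈ d.E, x0 k ^ (-q k j * l j) := Finset.prod_comm
        _ = _ := by
            refine Finset.prod_congr rfl fun k _ => ?_
            rw [hrel l hl k, ← Finset.sum_neg_distrib]
            have : ∀ T : Finset (Fin R), ∏ j ∈ T, x0 k ^ (-q k j * l j) =
                x0 k ^ ∑ j ∈ T, -(q k j * l j) := by
              intro T
              induction T using Finset.induction_on with
              | empty => simp
              | insert a T ha ih =>
                rw [Finset.prod_insert ha, Finset.sum_insert ha, zpow_add₀ (hx0 k), ih, neg_mul]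
            exact this _
    have h2 : ∏ k ∈ d.Eᶜ, x k ^ l k = ∏ k ∈ d.Eᶜ, x0 k ^ l k :=
      Finset.prod_congr rfl fun k hk => by rw [hxn k (Finset.mem_compl.1 hk)]
    rw [h1, h2, ← Finset.prod_mul_distrib]
    refine Finset.prod_eq_one fun k _ => ?_
    rw [← zpow_add₀ (hx0 k), neg_add_cancel, zpow_zero]
  have hne : ∀ j, x j ≠ 0 := by
    intro j
    by_cases hj : j ∈ d.E
    · rw [hxE j hj]
      exact Finset.prod_ne_zero_iff.2 fun k _ => zpow_ne_zero _ (hx0 k)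
    · rw [hxn j hj]
      exact hx0 j
  have hyA : ∀ j, d.y j ∈ A := fun j => zpow_one (d.y j) ▸ d.y_zpow_mem j 1
  have hfib : ∀ i, Finset.univ.filter (fun j => blk j = i) = P.S i := by
    intro i; ext j; simp [hblk']
  have hEA : ∀ b ∈ d.E, x b ∈ A := by
    intro b hb
    have hcalc : x b = (∏ k ∈ d.Eᶜ, d.y k ^ (-q k b)) * ∏ k ∈ d.Eᶜ, den (blk k) ^ q k b := by
      rw [hxE b hb, ← Finset.prod_mul_distrib]
      refine Finset.prod_congr rfl fun k _ => ?_
      simp only [x0]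
      rw [div_zpow, zpow_neg (den (blk k)), div_inv_eq_mul]
    rw [hcalc]
    refine mul_mem (prod_mem fun k _ => d.y_zpow_mem k _) ?_
    rw [← Finset.prod_fiberwise (d.Eᶜ) blk]
    refine prod_mem fun i _ => ?_
    have h1 : ∏ k ∈ d.Eᶜ with blk k = i, den (blk k) ^ q k b =
        ∏ k ∈ d.Eᶜ with blk k = i, den i ^ q k b :=
      Finset.prod_congr rfl fun k hk => by rw [(Finset.mem_filter.1 hk).2]
    rw [h1]
    induction i using Fin.lastCases with
    | last =>
      simp only [hdenl, one_zpow, Finset.prod_const_one]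
      exact one_mem _
    | cast i =>
      have h2 : (d.Eᶜ).filter (fun k => blk k = i.castSucc) = P.S i.castSucc := by
        ext k
        simp only [Finset.mem_filter, Finset.mem_compl, hblk']
        exact ⟨fun h => h.2, fun h => ⟨hSE i k ((hblk' _ _).2 h), h⟩⟩
      rw [h2]
      have h3 : ∀ T : Finset (Fin R), ∏ k ∈ T, den i.castSucc ^ q k b =
          den i.castSucc ^ ∑ k ∈ T, q k b := by
        intro T
        induction T using Finset.induction_on with
        | empty => simp
        | insert a T ha ih =>
          rw [Finset.prod_insert ha, Finset.sum_insert ha, zpow_add₀ (hden0 _), ih]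
      obtain ⟨a, ha⟩ := d.nonneg i
      have h4 : ∑ k ∈ P.S i.castSucc, q k b = (a b : ℤ) := by
        have h5 : ∑ k ∈ P.S i.castSucc, q k b = B.repr (L i) ⟨b, hb⟩ := by
          rw [← P.sum_eq i]
          simp [q, hb]
        have h6 : L i = ∑ t : d.E, (a t : ℤ) • B t := by
          rw [ha, ← Finset.sum_coe_sort]
          simp [B]
        rw [h5, h6, B.repr_sum_self]
      rw [h3, h4, zpow_natCast, hdenc]
      exact pow_mem (sum_mem fun k _ => hyA k) _
  have hsum : ∑ j, x j ∈ A := by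
    rw [← Finset.sum_fiberwise Finset.univ blk]
    refine sum_mem fun i _ => ?_
    rw [hfib]
    induction i using Fin.lastCases with
    | last =>
      refine sum_mem fun j hj => ?_
      by_cases hE : j ∈ d.E
      · exact hEA j hE
      · rw [hfree j hj hE]
        exact hyA j
    | cast i =>
      have : ∑ j ∈ P.S i.castSucc, x j = 1 := by
        rw [Finset.sum_congr rfl (hblock i), ← Finset.sum_div]
        exact div_self (d.sum_y_ne_zero _ ⟨_, d.s_mem i⟩)
      rw [this]
      exact one_mem _
  obtain ⟨f, hf⟩ := hsum
  exact ⟨f, x, ⟨hne, hrelx, hblock, hfree⟩, hf⟩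

end PrzyjalkowskiChoice

end

/-! Both mirrors are the potential `W = ∑ x_j` restricted to a complete intersection in the torus
dual to `Y`, cut out by the block sums of one nef partition being equal to `1`. It therefore
suffices to move one complete intersection to the other by a birational map that preserves `W` and
the residue volume form. Write `b` and `b'` for the block functions of the two partitions. Since the
divisors of corresponding blocks are linearly equivalent, the indicator of `b = i` minus that of `b'
= i` comes from a character `m_i`. Hence the rescaling `x̃_j = x_j h_{b j} / h_{b' j}` respects all
monomial relations, for any non-zero functions `h_i` (`isDualPoint_tilde`).

The factors are chosen so that the sum of `x̃` over each block of `b'` is the sum of `x` over the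
same block of `b`; this includes the last block, so `W` is preserved too. It is a linear system for
`h`: harmonicity on the digraph with an edge `b j → b' j` of weight `x_j` for each ray. Completeness
of the fan says that an effective principal divisor is zero, so a set of blocks that no edge leaves
is not entered either (`blk_mem_of_forall`). As the `x_j` have positive value at `1`, vertices can
be eliminated one by one without cancellation. This gives a non-vanishing `h`, unique once it is `1`
at one root of each component (`exists_harmonic`, `Exchange.nonempty`).

The map is birational because `h` also solves a regular linear system with coefficients in the
`x̃_j` (`Exchange.h_mem`). For the volume form, the differential is lifted to an endomorphism `Φ` of
the cotangent space `K^n` of the dual torus, which carries the differentials of the new block sums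
to those of the old ones. Its determinant is a sign, because the Laplacians of `x` and `x̃` are
transposes of each other up to conjugation (`det_linearization`, `exists_cotangent_lift`). The
coordinates of each mirror, completed by the differentials of the block sums, have determinant `±1`,
because the rays outside `E` form a basis of `N` (`det_quotRay`). -/

noncomputable section

/-! ### Elimination for weighted digraphs with positive weights -/

/-- A set of elements of a field that is closed under addition, multiplication and inversion and
does not contain zero. -/
structure PositiveSystem (K : Type*) [Field K] where
  carrier : Set K
  add_mem : ∀ {a b}, a ∈ carrier → b ∈ carrier → a + b ∈ carrier
  mul_mem : ∀ {a b}, a ∈ carrier → b ∈ carrier → a * b ∈ carrier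
  inv_mem : ∀ {a}, a ∈ carrier → a⁻¹ ∈ carrier
  one_mem : 1 ∈ carrier
  zero_notMem : 0 ∉ carrier

namespace PositiveSystem

variable {K : Type*} [Field K] (C : PositiveSystem K)

theorem ne_zero {a : K} (ha : a ∈ C.carrier) : a ≠ 0 :=
  fun h => C.zero_notMem (h ▸ ha)

theorem div_mem {a b : K} (ha : a ∈ C.carrier) (hb : b ∈ C.carrier) : a / b ∈ C.carrier :=
  div_eq_mul_inv a b ▸ C.mul_mem ha (C.inv_mem hb)

theorem zpow_mem {a : K} (ha : a ∈ C.carrier) (z : ℤ) : a ^ z ∈ C.carrier := by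
  have h : ∀ k : ℕ, a ^ k ∈ C.carrier := fun k => by
    induction k with
    | zero => simpa using C.one_mem
    | succ k ih => rw [pow_succ]; exact C.mul_mem ih ha
  obtain ⟨k, rfl | rfl⟩ := z.eq_nat_or_neg
  · simpa using h k
  · simpa using C.inv_mem (h k)

theorem prod_mem {ι : Type*} (s : Finset ι) (f : ι → K) (hf : ∀ i ∈ s, f i ∈ C.carrier) :
    ∏ i ∈ s, f i ∈ C.carrier := by
  classical
  induction s using Finset.induction_on with
  | empty => simpa using C.one_mem
  | insert a s ha ih =>
    rw [Finset.prod_insert ha]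
    exact C.mul_mem (hf a (by simp)) (ih fun i hi => hf i (by simp [hi]))

theorem add_mem_or {a b : K} (ha : a = 0 ∨ a ∈ C.carrier) (hb : b = 0 ∨ b ∈ C.carrier) :
    a + b = 0 ∨ a + b ∈ C.carrier := by
  rcases ha with rfl | ha <;> rcases hb with rfl | hb
  · simp
  · simp [hb]
  · simp [ha]
  · exact Or.inr (C.add_mem ha hb)

theorem mul_mem_or {a b : K} (ha : a = 0 ∨ a ∈ C.carrier) (hb : b = 0 ∨ b ∈ C.carrier) :
    a * b = 0 ∨ a * b ∈ C.carrier := by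
  rcases ha with rfl | ha
  · simp
  rcases hb with rfl | hb
  · simp
  · exact Or.inr (C.mul_mem ha hb)

/-- Positivity rules out cancellation, so a missing edge in an eliminated graph can be traced back
to missing edges in the original one. -/
theorem add_eq_zero {a b : K} (ha : a = 0 ∨ a ∈ C.carrier) (hb : b = 0 ∨ b ∈ C.carrier)
    (h : a + b = 0) : a = 0 ∧ b = 0 := by
  rcases ha with rfl | ha <;> rcases hb with rfl | hb
  · simp
  · simpa using h
  · simpa using h
  · exact absurd h (C.ne_zero (C.add_mem ha hb))

theorem sum_mem_or {ι : Type*} (s : Finset ι) (f : ι → K)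
    (hf : ∀ i ∈ s, f i = 0 ∨ f i ∈ C.carrier) :
    ∑ i ∈ s, f i = 0 ∨ ∑ i ∈ s, f i ∈ C.carrier := by
  classical
  induction s using Finset.induction_on with
  | empty => simp
  | insert a s ha ih =>
    rw [Finset.sum_insert ha]
    exact C.add_mem_or (hf a (by simp)) (ih fun i hi => hf i (by simp [hi]))

theorem sum_eq_zero {ι : Type*} (s : Finset ι) (f : ι → K)
    (hf : ∀ i ∈ s, f i = 0 ∨ f i ∈ C.carrier) (h : ∑ i ∈ s, f i = 0) : ∀ i ∈ s, f i = 0 := by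
  classical
  intro i hi
  rw [← Finset.add_sum_erase s f hi] at h
  exact (C.add_eq_zero (hf i hi)
    (C.sum_mem_or _ _ fun k hk => hf k (Finset.mem_of_mem_erase hk)) h).1

theorem sum_mem {ι : Type*} (s : Finset ι) (f : ι → K)
    (hf : ∀ i ∈ s, f i = 0 ∨ f i ∈ C.carrier) {i : ι} (hi : i ∈ s) (h : f i ≠ 0) :
    ∑ i ∈ s, f i ∈ C.carrier :=
  (C.sum_mem_or s f hf).resolve_left fun h0 => h (C.sum_eq_zero s f hf h0 i hi)

end PositiveSystem

/-- A weight matrix on `s` is balanced if every set that is closed under outgoing edges is closed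
under incoming edges. -/
def IsBalancedOn {V K : Type*} [Zero K] (s : Finset V) (X : V → V → K) : Prop :=
  ∀ I ⊆ s, (∀ i ∈ I, ∀ k ∈ s, k ∉ I → X i k = 0) → ∀ i ∈ I, ∀ k ∈ s, k ∉ I → X k i = 0

/-- Existence and uniqueness of a positive harmonic vector `h` for the Laplacian of a balanced
positive weight matrix, normalized to be `1` at one root of each component; `ν` is the set of
vertices that are not roots. -/
theorem exists_harmonic {V K : Type*} [DecidableEq V] [Field K] (C : PositiveSystem K)
    (s : Finset V) : ∀ (X : V → V → K),
      (∀ i ∈ s, ∀ k ∈ s, X i k = 0 ∨ X i k ∈ C.carrier) → IsBalancedOn s X →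
    ∃ (ν : Finset V) (h : V → K), ν ⊆ s ∧ (∀ i ∈ s, h i ∈ C.carrier) ∧
      (∀ i ∈ s, i ∉ ν → h i = 1) ∧
      (∀ k ∈ s, ∑ i ∈ s, X i k * h i = (∑ l ∈ s, X k l) * h k) ∧
      (∀ θ : V → K, (∀ i ∈ s, i ∉ ν → θ i = 0) →
        (∀ k ∈ ν, ∑ i ∈ s, X i k * θ i = (∑ l ∈ s, X k l) * θ k) → ∀ i ∈ s, θ i = 0) ∧
      (∀ ρ ∈ s, ρ ∉ ν → ∃ I ⊆ s, ρ ∈ I ∧ (∀ i ∈ I, i ≠ ρ → i ∈ ν) ∧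
        ∀ i ∈ I, ∀ k ∈ s, k ∉ I → X i k = 0 ∧ X k i = 0) := by
  induction s using Finset.induction_on with
  | empty =>
    intro X _ _
    exact ⟨∅, fun _ => 1, by simp⟩
  | insert v s hv ih =>
    intro X hX hQ
    have hXvs : ∀ l ∈ s, X v l = 0 ∨ X v l ∈ C.carrier := fun l hl =>
      hX v (by simp) l (by simp [hl])
    have hXsv : ∀ l ∈ s, X l v = 0 ∨ X l v ∈ C.carrier := fun l hl =>
      hX l (by simp [hl]) v (by simp)
    have hXs : ∀ i ∈ s, ∀ k ∈ s, X i k = 0 ∨ X i k ∈ C.carrier := fun i hi k hk =>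
      hX i (by simp [hi]) k (by simp [hk])
    have hvne : ∀ i ∈ s, i ≠ v := fun i hi h => hv (h ▸ hi)
    -- If no edge leaves `v` for `s`, balance forbids edges entering it. Then `v` is a component by
    -- itself and becomes a root.
    by_cases hp0 : ∑ l ∈ s, X v l = 0
    · have hout : ∀ l ∈ s, X v l = 0 := C.sum_eq_zero s _ hXvs hp0
      have hin : ∀ l ∈ s, X l v = 0 := fun l hl =>
        hQ {v} (by simp) (by
          intro i hi k hk hkv
          simp only [Finset.mem_singleton] at hi hkv
          subst hi
          exact hout k (by simpa [hkv] using hk)) v (by simp) l (by simp [hl])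
          (by simpa using hvne l hl)
      have hQs : IsBalancedOn s X := by
        intro I hI hcl i hi k hk hkI
        refine hQ I (hI.trans (Finset.subset_insert _ _)) ?_ i hi k (by simp [hk]) hkI
        intro i hi k hk hkI
        rcases Finset.mem_insert.1 hk with rfl | hk
        · exact hin i (hI hi)
        · exact hcl i hi k hk hkI
      obtain ⟨ν, h, hν, hpos, hroot, hharm, huniq, hcomp⟩ := ih X hXs hQs
      have hvν : v ∉ ν := fun h => hv (hν h)
      refine ⟨ν, Function.update h v 1, hν.trans (Finset.subset_insert _ _), ?_, ?_, ?_, ?_, ?_⟩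
      · intro i hi
        rcases Finset.mem_insert.1 hi with rfl | hi
        · simpa using C.one_mem
        · rw [Function.update_of_ne (hvne i hi)]
          exact hpos i hi
      · intro i hi hiν
        rcases Finset.mem_insert.1 hi with rfl | hi
        · simp
        · rw [Function.update_of_ne (hvne i hi)]
          exact hroot i hi hiν
      · intro k hk
        rw [Finset.sum_insert hv, Finset.sum_insert hv]
        have e : ∑ i ∈ s, X i k * Function.update h v 1 i = ∑ i ∈ s, X i k * h i :=
          Finset.sum_congr rfl fun i hi => by rw [Function.update_of_ne (hvne i hi)]
        rw [e]
        rcases Finset.mem_insert.1 hk with rfl | hk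
        · rw [hp0, Finset.sum_eq_zero fun i hi => by rw [hin i hi, zero_mul]]
          simp
        · rw [hharm k hk, Function.update_of_ne (hvne k hk), hout k hk, hin k hk]
          simp
      · intro θ hθ0 hθ
        have hθv : θ v = 0 := hθ0 v (by simp) hvν
        have := huniq θ (fun i hi => hθ0 i (by simp [hi])) fun k hk => by
          have := hθ k hk
          rw [Finset.sum_insert hv, Finset.sum_insert hv, hin k (hν hk), hout k (hν hk)] at this
          simpa using this
        intro i hi
        rcases Finset.mem_insert.1 hi with rfl | hi
        · exact hθv
        · exact this i hi
      · intro ρ hρ hρν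
        rcases Finset.mem_insert.1 hρ with rfl | hρ
        · refine ⟨{ρ}, by simp, by simp, by simp, ?_⟩
          intro i hi k hk hkρ
          simp only [Finset.mem_singleton] at hi hkρ
          subst hi
          have hk : k ∈ s := by simpa [hkρ] using hk
          exact ⟨hout k hk, hin k hk⟩
        · obtain ⟨I, hI, hρI, hIν, hIc⟩ := hcomp ρ hρ hρν
          refine ⟨I, hI.trans (Finset.subset_insert _ _), hρI, hIν, ?_⟩
          intro i hi k hk hkI
          rcases Finset.mem_insert.1 hk with rfl | hk
          · exact ⟨hin i (hI hi), hout i (hI hi)⟩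
          · exact hIc i hi k hk hkI
    · set p := ∑ l ∈ s, X v l with hp
      have hpC : p ∈ C.carrier := (C.sum_mem_or s _ hXvs).resolve_left hp0
      obtain ⟨o, ho, hvo⟩ : ∃ o ∈ s, X v o ≠ 0 := by
        by_contra! hcon
        exact hp0 (Finset.sum_eq_zero hcon)
      -- An edge must also enter `v`: otherwise nothing leaves `s`, and balance would kill the edge
      -- from `v` to `o`. This edge makes the value of `h` at `v` positive.
      obtain ⟨u, hu, huv⟩ : ∃ u ∈ s, X u v ≠ 0 := by
        by_contra! hcon
        refine hvo (hQ s (Finset.subset_insert _ _) ?_ o ho v (by simp) hv)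
        intro i hi k hk hks
        rcases Finset.mem_insert.1 hk with rfl | hk
        · exact hcon i hi
        · exact absurd hk hks
      -- Gaussian elimination of `v`: a path `i → v → k` is replaced by an edge. Loops are harmless,
      -- since they contribute equally to both sides of the harmonic equation.
      set Z : V → V → K := fun i k => X i k + X i v * X v k / p with hZ
      have hterm : ∀ i ∈ s, ∀ k ∈ s, X i v * X v k / p = 0 ∨ X i v * X v k / p ∈ C.carrier := by
        intro i hi k hk
        rw [div_eq_mul_inv]
        exact C.mul_mem_or (C.mul_mem_or (hXsv i hi) (hXvs k hk)) (Or.inr (C.inv_mem hpC))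
      have hZC : ∀ i ∈ s, ∀ k ∈ s, Z i k = 0 ∨ Z i k ∈ C.carrier := fun i hi k hk =>
        C.add_mem_or (hXs i hi k hk) (hterm i hi k hk)
      have hZ0 : ∀ i ∈ s, ∀ k ∈ s, Z i k = 0 → X i k = 0 ∧ (X i v = 0 ∨ X v k = 0) := by
        intro i hi k hk h0
        obtain ⟨h1, h2⟩ := C.add_eq_zero (hXs i hi k hk) (hterm i hi k hk) h0
        refine ⟨h1, ?_⟩
        simpa [hp0] using h2
      have hZ0' : ∀ i k, X i k = 0 → (X i v = 0 ∨ X v k = 0) → Z i k = 0 := by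
        intro i k h1 h2
        rcases h2 with h2 | h2 <;> simp [hZ, h1, h2]
      have hrow : ∀ k, ∑ l ∈ s, Z k l = X k v + ∑ l ∈ s, X k l := by
        intro k
        simp only [hZ, Finset.sum_add_distrib, ← Finset.sum_div, ← Finset.mul_sum, ← hp]
        rw [mul_div_assoc, div_self hp0]
        ring
      have hQs : IsBalancedOn s Z := by
        intro I hI hcl i hi k hk hkI
        -- If an edge leads from `I` to `v`, the set `insert v I` is closed in the original graph;
        -- otherwise `I` itself is.
        by_cases hIv : ∃ a ∈ I, X a v ≠ 0
        · obtain ⟨a, ha, hav⟩ := hIv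
          have hvI : ∀ k ∈ s, k ∉ I → X v k = 0 := fun k hk hkI =>
            ((hZ0 a (hI ha) k hk (hcl a ha k hk hkI)).2).resolve_left hav
          have hcl' := hQ (insert v I) (Finset.insert_subset_insert _ hI) (by
            intro i hi k hk hkI
            simp only [Finset.mem_insert, not_or] at hkI
            have hks : k ∈ s := by simpa [hkI.1] using hk
            rcases Finset.mem_insert.1 hi with rfl | hi
            · exact hvI k hks hkI.2
            · exact (hZ0 i (hI hi) k hks (hcl i hi k hks hkI.2)).1)
          have hkI' : k ∉ insert v I := by simp [hkI, hvne k hk]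
          exact hZ0' _ _ (hcl' i (by simp [hi]) k (by simp [hk]) hkI')
            (Or.inl (hcl' v (by simp) k (by simp [hk]) hkI'))
        · push Not at hIv
          have hcl' := hQ I (hI.trans (Finset.subset_insert _ _)) (by
            intro i hi k hk hkI
            rcases Finset.mem_insert.1 hk with rfl | hk
            · exact hIv i hi
            · exact (hZ0 i (hI hi) k hk (hcl i hi k hk hkI)).1)
          exact hZ0' _ _ (hcl' i hi k (by simp [hk]) hkI)
            (Or.inr (hcl' i hi v (by simp) fun h => hv (hI h)))
      obtain ⟨ν, h, hν, hpos, hroot, hharm, huniq, hcomp⟩ := ih Z hZC hQs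
      -- The value forced by the harmonic equation at `v`.
      set hv' := (∑ i ∈ s, X i v * h i) / p with hhv
      have hsub : ∀ (θ : V → K) (k : V), θ v = (∑ i ∈ s, X i v * θ i) / p →
          ∑ i ∈ s, Z i k * θ i = X v k * θ v + ∑ i ∈ s, X i k * θ i := by
        intro θ k hθ
        rw [hθ, mul_div_assoc', Finset.mul_sum, Finset.sum_div, ← Finset.sum_add_distrib]
        refine Finset.sum_congr rfl fun i _ => ?_
        simp only [hZ]
        ring
      refine ⟨insert v ν, Function.update h v hv', Finset.insert_subset_insert _ hν, ?_, ?_, ?_,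
        ?_, ?_⟩
      · intro i hi
        rcases Finset.mem_insert.1 hi with rfl | hi
        · rw [Function.update_self]
          refine C.div_mem ?_ hpC
          exact C.sum_mem _ _ (fun l hl => C.mul_mem_or (hXsv l hl) (Or.inr (hpos l hl))) hu
            (mul_ne_zero huv (C.ne_zero (hpos u hu)))
        · rw [Function.update_of_ne (hvne i hi)]
          exact hpos i hi
      · intro i hi hiν
        simp only [Finset.mem_insert, not_or] at hiν hi
        rw [Function.update_of_ne hiν.1]
        exact hroot i (by tauto) hiν.2
      · intro k hk
        have e : ∀ k, ∑ i ∈ s, X i k * Function.update h v hv' i = ∑ i ∈ s, X i k * h i :=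
          fun k => Finset.sum_congr rfl fun i hi => by rw [Function.update_of_ne (hvne i hi)]
        have e' : ∑ i ∈ s, Z i k * Function.update h v hv' i = ∑ i ∈ s, Z i k * h i :=
          Finset.sum_congr rfl fun i hi => by rw [Function.update_of_ne (hvne i hi)]
        have hθ : Function.update h v hv' v =
            (∑ i ∈ s, X i v * Function.update h v hv' i) / p := by
          rw [e, Function.update_self]
        rw [Finset.sum_insert hv, Finset.sum_insert hv]
        rcases Finset.mem_insert.1 hk with rfl | hk
        · have : (∑ i ∈ s, X i k * Function.update h k hv' i) =
              p * Function.update h k hv' k := by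
            rw [hθ, mul_div_cancel₀ _ hp0]
          rw [this]
          ring
        · rw [← hsub _ k hθ, e', hharm k hk, hrow, Function.update_of_ne (hvne k hk)]
      · intro θ hθ0 hθ
        have hθv : θ v = (∑ i ∈ s, X i v * θ i) / p := by
          have := hθ v (by simp)
          rw [Finset.sum_insert hv, Finset.sum_insert hv, add_mul] at this
          rw [add_left_cancel this, ← hp, mul_div_cancel_left₀ _ hp0]
        have := huniq θ (fun i hi hiν => hθ0 i (by simp [hi]) (by simp [hiν, hvne i hi]))
          fun k hk => by
            rw [hsub θ k hθv, hrow, ← Finset.sum_insert hv (f := fun i => X i k * θ i),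
              hθ k (by simp [hk]), Finset.sum_insert hv]
        intro i hi
        rcases Finset.mem_insert.1 hi with rfl | hi
        · rw [hθv, Finset.sum_eq_zero fun l hl => by rw [this l hl, mul_zero], zero_div]
        · exact this i hi
      · intro ρ hρ hρν
        simp only [Finset.mem_insert, not_or] at hρν hρ
        obtain ⟨I, hI, hρI, hIν, hIc⟩ := hcomp ρ (by tauto) hρν.2
        -- The component of `ρ` absorbs `v` if it touches `v`. In that case edges run both ways
        -- between `I` and `v`, because a path through `v` with only one end in `I` would give an
        -- edge of `Z` leaving or entering `I`.
        by_cases hIv : ∃ a ∈ I, X a v ≠ 0 ∨ X v a ≠ 0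
        · have hvI : ∀ k ∈ s, k ∉ I → X v k = 0 ∧ X k v = 0 := by
            have hio : ∃ a ∈ I, X a v ≠ 0 := by
              obtain ⟨a, ha, h | h⟩ := hIv
              · exact ⟨a, ha, h⟩
              · refine ⟨u, ?_, huv⟩
                by_contra huI
                exact ((hZ0 u hu a (hI ha) (hIc a ha u hu huI).2).2).elim huv h
            have hoo : ∃ a ∈ I, X v a ≠ 0 := by
              obtain ⟨a, ha, h⟩ := hio
              refine ⟨o, ?_, hvo⟩
              by_contra hoI
              exact ((hZ0 a (hI ha) o ho (hIc a ha o ho hoI).1).2).elim h hvo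
            intro k hk hkI
            obtain ⟨a, ha, hav⟩ := hio
            obtain ⟨b, hb, hvb⟩ := hoo
            exact ⟨((hZ0 a (hI ha) k hk (hIc a ha k hk hkI).1).2).resolve_left hav,
              ((hZ0 k hk b (hI hb) (hIc b hb k hk hkI).2).2).resolve_right hvb⟩
          refine ⟨insert v I, Finset.insert_subset_insert _ hI, by simp [hρI], ?_, ?_⟩
          · intro i hi hiρ
            rcases Finset.mem_insert.1 hi with rfl | hi
            · simp
            · simp [hIν i hi hiρ]
          · intro i hi k hk hkI
            simp only [Finset.mem_insert, not_or] at hkI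
            have hks : k ∈ s := by simpa [hkI.1] using hk
            rcases Finset.mem_insert.1 hi with rfl | hi
            · exact hvI k hks hkI.2
            · exact ⟨(hZ0 i (hI hi) k hks (hIc i hi k hks hkI.2).1).1,
                (hZ0 k hks i (hI hi) (hIc i hi k hks hkI.2).2).1⟩
        · push Not at hIv
          refine ⟨I, hI.trans (Finset.subset_insert _ _), hρI,
            fun i hi hiρ => by simp [hIν i hi hiρ], ?_⟩
          intro i hi k hk hkI
          rcases Finset.mem_insert.1 hk with rfl | hk
          · exact hIv i hi
          · exact ⟨(hZ0 i (hI hi) k hk (hIc i hi k hk hkI).1).1,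
              (hZ0 k hk i (hI hi) (hIc i hi k hk hkI).2).1⟩

end

noncomputable section

/-! ### Function fields of tori -/

/-- Finitely many generators of a field extension, as many as an algebraically independent family
has members, are algebraically independent. -/
theorem algebraicIndependent_of_adjoin_eq_top {J J' K : Type} [Field K] [Algebra ℂ K] [Finite J']
    (hc : Nat.card J = Nat.card J') {u : J → K} (hu : AlgebraicIndependent ℂ u) {w : J' → K}
    (hw : IntermediateField.adjoin ℂ (Set.range w) = ⊤) : AlgebraicIndependent ℂ w := by
  have halg : Algebra.IsAlgebraic (Algebra.adjoin ℂ (Set.range w)) K := by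
    constructor
    intro z
    have hz : z ∈ IntermediateField.adjoin ℂ (Set.range w) := hw ▸ IntermediateField.mem_top
    obtain ⟨r, hr, s, hs, rfl⟩ := IntermediateField.mem_adjoin_iff_div.1 hz
    rw [div_eq_mul_inv]
    exact (isAlgebraic_algebraMap (⟨r, hr⟩ : Algebra.adjoin ℂ (Set.range w))).mul
      (isAlgebraic_algebraMap (⟨s, hs⟩ : Algebra.adjoin ℂ (Set.range w))).inv
  refine (Algebra.IsAlgebraic.isTranscendenceBasis_of_le_trdeg_of_finite ℂ w ?_).1
  refine le_trans ?_ hu.cardinalMk_le_trdeg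
  -- For empty `J'` the equality of `Nat.card` leaves room for an infinite `J`, but then there is
  -- nothing to bound.
  by_cases hJ' : IsEmpty J'
  · simp
  · have : Finite J := Nat.finite_of_card_ne_zero (by
      rw [hc]
      have := not_isEmpty_iff.1 hJ'
      exact Nat.card_pos.ne')
    rw [← Nat.cast_card, ← Nat.cast_card, hc]

namespace TorusFunctionField

variable {J : Type}

/-- The inclusion of polynomials into Laurent polynomials. -/
def polyToLaurent (J : Type) : MvPolynomial J ℂ →ₐ[ℂ] LaurentRing J :=
  AddMonoidAlgebra.mapDomainAlgHom ℂ ℂ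
    (Finsupp.mapRange.addMonoidHom (Nat.castAddMonoidHom ℤ) : (J →₀ ℕ) →+ (J →₀ ℤ))

theorem polyToLaurent_monomial (a : J →₀ ℕ) (z : ℂ) :
    polyToLaurent J (MvPolynomial.monomial a z) =
      AddMonoidAlgebra.single (a.mapRange (Nat.cast : ℕ → ℤ) Nat.cast_zero) z := by
  exact AddMonoidAlgebra.mapDomain_single

theorem polyToLaurent_X (j : J) :
    polyToLaurent J (MvPolynomial.X j) = AddMonoidAlgebra.single (Finsupp.single j 1) 1 := by
  rw [MvPolynomial.X, polyToLaurent_monomial]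
  simp

theorem polyToLaurent_injective : Function.Injective (polyToLaurent J) := by
  refine AddMonoidAlgebra.mapDomain_injective ?_
  intro a b h
  ext j
  have := DFunLike.congr_fun h j
  simpa using this

/-- Laurent polynomials have monomial denominators. Clearing them reduces injectivity and membership
questions to ordinary polynomials. -/
theorem exists_monomial_mul (p : LaurentRing J) : ∃ (a : J →₀ ℕ) (q : MvPolynomial J ℂ),
    polyToLaurent J (MvPolynomial.monomial a 1) * p = polyToLaurent J q := by
  classical
  induction p using AddMonoidAlgebra.induction_linear with
  | zero => exact ⟨0, 0, by simp⟩
  | add p q hp hq =>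
    obtain ⟨a, p', hp⟩ := hp
    obtain ⟨b, q', hq⟩ := hq
    refine ⟨a + b, MvPolynomial.monomial b 1 * p' + MvPolynomial.monomial a 1 * q', ?_⟩
    have : MvPolynomial.monomial (a + b) (1 : ℂ) =
        MvPolynomial.monomial a 1 * MvPolynomial.monomial b 1 := by
      simp [MvPolynomial.monomial_mul]
    rw [this, map_add, map_mul, map_mul, map_mul, ← hp, ← hq]
    ring
  | single a z =>
    refine ⟨a.mapRange (fun t => (-t).toNat) (by simp),
      MvPolynomial.monomial (a.mapRange Int.toNat (by simp)) z, ?_⟩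
    rw [polyToLaurent_monomial, polyToLaurent_monomial, AddMonoidAlgebra.single_mul_single, one_mul]
    congr 1
    ext j
    simp
    omega

theorem algebraicIndependent_torusCoord :
    AlgebraicIndependent ℂ (torusCoord : J → TorusFunctionField J) := by
  have : (MvPolynomial.aeval (torusCoord : J → TorusFunctionField J)) =
      (IsScalarTower.toAlgHom ℂ (LaurentRing J) (TorusFunctionField J)).comp (polyToLaurent J) := by
    ext j
    simp [polyToLaurent_X, torusCoord]
  rw [AlgebraicIndependent, this]
  exact (IsFractionRing.injective _ _).comp polyToLaurent_injective

theorem algHom_eq_aeval {K : Type} [Field K] [Algebra ℂ K] (φ : LaurentRing J →ₐ[ℂ] K)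
    (q : MvPolynomial J ℂ) : φ (polyToLaurent J q) =
      MvPolynomial.aeval (fun j => φ (AddMonoidAlgebra.single (Finsupp.single j 1) 1)) q := by
  have : φ.comp (polyToLaurent J) =
      MvPolynomial.aeval (fun j => φ (AddMonoidAlgebra.single (Finsupp.single j 1) 1)) := by
    ext j
    simp [polyToLaurent_X]
  rw [← this]
  rfl

theorem monomial_ne_zero {K : Type} [Field K] [Algebra ℂ K] (φ : LaurentRing J →ₐ[ℂ] K)
    (a : J →₀ ℕ) : φ (polyToLaurent J (MvPolynomial.monomial a 1)) ≠ 0 := by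
  rw [polyToLaurent_monomial]
  refine ((IsUnit.of_mul_eq_one (AddMonoidAlgebra.single
    (-a.mapRange (Nat.cast : ℕ → ℤ) Nat.cast_zero) 1) ?_).map φ).ne_zero
  rw [AddMonoidAlgebra.single_mul_single, add_neg_cancel, mul_one]
  rfl

theorem mem_of_torusCoord_mem {K : Type} [Field K] [Algebra ℂ K] (φ : LaurentRing J →ₐ[ℂ] K)
    (F : IntermediateField ℂ K)
    (hF : ∀ j, φ (AddMonoidAlgebra.single (Finsupp.single j 1) 1) ∈ F) (p : LaurentRing J) :
    φ p ∈ F := by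
  have hq : ∀ q, φ (polyToLaurent J q) ∈ F := by
    intro q
    rw [algHom_eq_aeval]
    exact Algebra.adjoin_le (S := F.toSubalgebra) (by rintro _ ⟨j, rfl⟩; exact hF j)
      (Algebra.adjoin_range_eq_range_aeval ℂ (fun j =>
        φ (AddMonoidAlgebra.single (Finsupp.single j 1) 1)) ▸ AlgHom.mem_range_self _ q)
  obtain ⟨a, q, h⟩ := exists_monomial_mul p
  have h1 := congrArg φ h
  rw [map_mul] at h1
  rw [eq_div_of_mul_eq (monomial_ne_zero φ a) ((mul_comm _ _).trans h1)]
  exact div_mem (hq _) (hq _)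

theorem eq_top_of_torusCoord_mem (F : IntermediateField ℂ (TorusFunctionField J))
    (hF : ∀ j, torusCoord j ∈ F) : F = ⊤ := by
  rw [eq_top_iff]
  intro z _
  obtain ⟨p, q, -, rfl⟩ := IsFractionRing.div_surjective (A := LaurentRing J) z
  exact div_mem
    (mem_of_torusCoord_mem (IsScalarTower.toAlgHom ℂ (LaurentRing J) (TorusFunctionField J)) F hF p)
    (mem_of_torusCoord_mem (IsScalarTower.toAlgHom ℂ (LaurentRing J) (TorusFunctionField J)) F hF q)

/-- The homomorphism out of the ring of Laurent polynomials given by the values of the variables. -/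
def laurentLift {K : Type} [Field K] [Algebra ℂ K] (w : J → Kˣ) : LaurentRing J →ₐ[ℂ] K :=
  AddMonoidAlgebra.lift ℂ K (J →₀ ℤ)
    ((Units.coeHom K).comp (AddMonoidHom.toMultiplicativeLeft
      (Finsupp.liftAddHom fun j => (zmultiplesHom (Additive Kˣ) (Additive.ofMul (w j))))))

theorem laurentLift_single {K : Type} [Field K] [Algebra ℂ K] (w : J → Kˣ) (j : J) :
    laurentLift w (AddMonoidAlgebra.single (Finsupp.single j 1) 1) = w j := by
  simp [laurentLift]

/-- Rational functions `w` on a torus that generate its function field, as many as its dimension,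
are the coordinates of a birational map to a torus. -/
theorem exists_algEquiv {J' : Type} [Finite J'] (hc : Nat.card J = Nat.card J')
    (w : J' → TorusFunctionField J) (hw0 : ∀ j, w j ≠ 0)
    (hw : IntermediateField.adjoin ℂ (Set.range w) = ⊤) :
    ∃ ψ : TorusFunctionField J' ≃ₐ[ℂ] TorusFunctionField J, ∀ j, ψ (torusCoord j) = w j := by
  have hind := algebraicIndependent_of_adjoin_eq_top hc algebraicIndependent_torusCoord hw
  set φ := laurentLift fun j => Units.mk0 (w j) (hw0 j) with hφ
  have hφs : ∀ j, φ (AddMonoidAlgebra.single (Finsupp.single j 1) 1) = w j := fun j => by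
    rw [hφ, laurentLift_single]; rfl
  -- After multiplication by a monomial, an element of the kernel is a polynomial relation among the
  -- algebraically independent `w j`.
  have hinj : Function.Injective φ := by
    rw [injective_iff_map_eq_zero]
    intro p hp
    obtain ⟨a, q, h⟩ := exists_monomial_mul p
    have h1 := congrArg φ h
    rw [map_mul, hp, mul_zero, algHom_eq_aeval] at h1
    simp_rw [hφs] at h1
    have hq : q = 0 := hind (by rw [← h1, map_zero])
    rw [hq, map_zero] at h
    exact (mul_eq_zero.1 h).resolve_left fun h0 =>
      monomial_ne_zero φ a (by rw [h0, map_zero])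
  let ψ : TorusFunctionField J' →ₐ[ℂ] TorusFunctionField J :=
    IsFractionRing.liftAlgHom (K := TorusFunctionField J') (g := φ) hinj
  have hψ : ∀ j, ψ (torusCoord j) = w j := fun j => by
    rw [← hφs j]
    exact IsFractionRing.lift_algebraMap hinj _
  have hsurj : Function.Surjective ψ := by
    rw [← AlgHom.fieldRange_eq_top, eq_top_iff, ← hw, IntermediateField.adjoin_le_iff]
    rintro _ ⟨j, rfl⟩
    exact ⟨torusCoord j, hψ j⟩
  exact ⟨AlgEquiv.ofBijective ψ ⟨ψ.toRingHom.injective, hsurj⟩, hψ⟩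

open scoped ComplexOrder in
/-- The rational functions on a torus that are regular at `1` with positive value. -/
def positiveSystem (J : Type) : PositiveSystem (TorusFunctionField J) :=
  let ε : LaurentRing J →ₐ[ℂ] ℂ := AddMonoidAlgebra.lift ℂ ℂ (J →₀ ℤ) 1
  have hne : ∀ p : LaurentRing J, 0 < ε p →
      algebraMap (LaurentRing J) (TorusFunctionField J) p ≠ 0 := by
    intro p hp h
    rw [map_eq_zero_iff _ (IsFractionRing.injective _ _)] at h
    rw [h, map_zero] at hp
    exact hp.ne rfl
  { carrier := {z | ∃ p q : LaurentRing J, 0 < ε p ∧ 0 < ε q ∧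
      z = algebraMap _ (TorusFunctionField J) p / algebraMap _ (TorusFunctionField J) q}
    add_mem := by
      rintro _ _ ⟨p, q, hp, hq, rfl⟩ ⟨p', q', hp', hq', rfl⟩
      refine ⟨p * q' + q * p', q * q', ?_, ?_, ?_⟩
      · rw [map_add, map_mul, map_mul]
        exact add_pos (mul_pos hp hq') (mul_pos hq hp')
      · rw [map_mul]; exact mul_pos hq hq'
      · rw [div_add_div _ _ (hne q hq) (hne q' hq')]
        simp
    mul_mem := by
      rintro _ _ ⟨p, q, hp, hq, rfl⟩ ⟨p', q', hp', hq', rfl⟩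
      refine ⟨p * p', q * q', ?_, ?_, ?_⟩
      · rw [map_mul]; exact mul_pos hp hp'
      · rw [map_mul]; exact mul_pos hq hq'
      · simp [div_mul_div_comm]
    inv_mem := by
      rintro _ ⟨p, q, hp, hq, rfl⟩
      exact ⟨q, p, hq, hp, by simp⟩
    one_mem := ⟨1, 1, by simp, by simp, by simp⟩
    zero_notMem := by
      rintro ⟨p, q, hp, hq, h⟩
      exact div_ne_zero (hne p hp) (hne q hq) h.symm }

open scoped ComplexOrder in
theorem torusCoord_mem_positiveSystem (j : J) : torusCoord j ∈ (positiveSystem J).carrier :=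
  ⟨AddMonoidAlgebra.single (Finsupp.single j 1) 1, 1, by simp, by simp, by simp [torusCoord]⟩

end TorusFunctionField

end

noncomputable section

/-! ### Determinants and alternating maps -/

/-- Pulled back to `K^ι` along the linear combinations of `v`, the map `f` is a top form, hence a
multiple of the determinant. -/
theorem AlternatingMap.map_sum_smul {ι K W U : Type*} [Fintype ι] [DecidableEq ι] [Field K]
    [AddCommGroup W] [Module K W] [AddCommGroup U] [Module K U] (f : W [⋀^ι]→ₗ[K] U)
    (C : Matrix ι ι K) (v : ι → W) : f (fun i => ∑ j, C i j • v j) = C.det • f v := by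
  let g := f.compLinearMap (Fintype.linearCombination K v)
  let b := Pi.basisFun K ι
  have hg : g = (LinearMap.toSpanSingleton K U (g b)).compAlternatingMap b.det := by
    refine Module.Basis.ext_alternating b fun i hi => ?_
    let σ : Equiv.Perm ι := Equiv.ofBijective i (Finite.injective_iff_bijective.1 hi)
    change g (b ∘ σ) = LinearMap.toSpanSingleton K U (g b) (b.det (b ∘ σ))
    rw [AlternatingMap.map_perm, AlternatingMap.map_perm, Module.Basis.det_self]
    rcases Int.units_eq_one_or (Equiv.Perm.sign σ) with h | h <;> simp [h]
  have h1 : g (fun i j => C i j) = f (fun i => ∑ j, C i j • v j) := rfl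
  have h2 : g b = f v := by
    change f (fun i => Fintype.linearCombination K v (b i)) = f v
    congr 1
    ext i
    simp [b, Fintype.linearCombination_apply, Pi.single_apply]
  have h3 : b.det (fun i j => C i j) = C.det := by
    rw [Module.Basis.det_apply, ← Matrix.det_transpose C]
    congr 1
  rw [← h1, hg, ← h2, ← h3]
  rfl

/-- Adapting a family of vectors to a quotient: the differences `v j - w i` and the affine
combinations of the `v j` and `w i` have the determinant of the family itself. -/
theorem AlternatingMap.map_differences_barycenters {ι ι' K W U : Type*} [Fintype ι]
    [DecidableEq ι] [Fintype ι'] [DecidableEq ι'] [Field K] [AddCommGroup W] [Module K W]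
    [AddCommGroup U] [Module K U] (f : W [⋀^(ι ⊕ ι')]→ₗ[K] U) (v : ι → W) (w : ι' → W)
    (T : ι → ι' → Prop) [∀ j i, Decidable (T j i)] (hT : ∀ j i i', T j i → T j i' → i = i')
    (a : ι → K) (a' : ι' → K) (ha : ∀ i, a' i + ∑ j, (if T j i then a j else 0) = 1) :
    f (Sum.elim (fun j => v j - ∑ i, (if T j i then w i else 0))
      (fun i => a' i • w i + ∑ j, (if T j i then a j • v j else 0))) = f (Sum.elim v w) := by
  -- The change of family. Its Schur complement is the identity: the diagonal entries are the sums
  -- of the affine weights, and the others vanish because each `j` belongs to at most one `i`.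
  let C : Matrix (ι ⊕ ι') (ι ⊕ ι') K :=
    Matrix.fromBlocks 1 (-Matrix.of fun j i => if T j i then 1 else 0)
      (Matrix.of fun i j => if T j i then a j else 0) (Matrix.diagonal a')
  have hdet : C.det = 1 := by
    rw [Matrix.det_fromBlocks_one₁₁]
    convert Matrix.det_one (n := ι') (R := K)
    ext i i'
    simp only [Matrix.mul_neg, sub_neg_eq_add, Matrix.add_apply, Matrix.mul_apply, Matrix.of_apply]
    by_cases h : i = i'
    · subst h
      rw [Matrix.diagonal_apply_eq, Matrix.one_apply_eq]
      refine Eq.trans (congrArg (a' i + ·) ?_) (ha i)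
      exact Finset.sum_congr rfl fun j _ => by split_ifs <;> simp
    · rw [Matrix.diagonal_apply_ne _ h, Matrix.one_apply_ne h, zero_add]
      refine Finset.sum_eq_zero fun j _ => ?_
      split_ifs with h1 h2
      · exact absurd (hT j i i' h1 h2) h
      all_goals simp
  have := f.map_sum_smul C (Sum.elim v w)
  rw [hdet, one_smul] at this
  rw [← this]
  congr 1
  funext i
  rcases i with j | i
  · simp [C, Fintype.sum_sum_type, Matrix.one_apply, ite_smul, sub_eq_add_neg]
  · simp [C, Fintype.sum_sum_type, Matrix.diagonal_apply, ite_smul]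
    rw [add_comm]

/-- Top forms on the quotient of a vector space by the span of `κ`, expressed by determinants of
lifts. -/
theorem AlternatingMap.det_smul_map_quotient {m c : ℕ} {K W Ω U : Type*} [Field K]
    [AddCommGroup W] [Module K W] [AddCommGroup Ω] [Module K Ω] [AddCommGroup U] [Module K U]
    (b : Module.Basis (Fin m ⊕ Fin c) K W) (f : Ω [⋀^Fin m]→ₗ[K] U) (π : W →ₗ[K] Ω)
    (u w : Fin m → W) (κ : Fin c → W) (hκ : ∀ i, π (κ i) = 0)
    (hu : b.det (Sum.elim u κ) ≠ 0) :
    b.det (Sum.elim u κ) • f (fun i => π (w i)) = b.det (Sum.elim w κ) • f (fun i => π (u i)) := by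
  obtain ⟨hli, hsp⟩ := (Module.Basis.is_basis_iff_det b).2 hu.isUnit
  let B : Module.Basis (Fin m ⊕ Fin c) K W := Module.Basis.mk hli hsp.ge
  -- Modulo the span of `κ`, the matrix `Q` expresses `w` in terms of `u`. Its determinant is the
  -- factor both between the lifted determinants and between the forms on the quotient.
  let Q : Matrix (Fin m) (Fin m) K := Matrix.of fun i k => B.repr (w i) (Sum.inl k)
  let Q' : Matrix (Fin m) (Fin c) K := Matrix.of fun i k => B.repr (w i) (Sum.inr k)
  have hw : ∀ i, w i = ∑ k, Q i k • u k + ∑ k, Q' i k • κ k := by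
    intro i
    conv_lhs => rw [← B.sum_repr (w i)]
    simp [Fintype.sum_sum_type, B, Q, Q']
  have h1 : b.det (Sum.elim w κ) = Q.det * b.det (Sum.elim u κ) := by
    have := b.det.map_sum_smul (Matrix.fromBlocks Q Q' 0 1) (Sum.elim u κ)
    rw [Matrix.det_fromBlocks_zero₂₁, Matrix.det_one, mul_one] at this
    rw [← smul_eq_mul, ← this]
    congr 1
    funext i
    rcases i with i | i
    · simp [Fintype.sum_sum_type, hw i]
    · simp [Fintype.sum_sum_type, Matrix.one_apply]
  have h2 : f (fun i => π (w i)) = Q.det • f (fun i => π (u i)) := by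
    rw [← f.map_sum_smul]
    congr 1
    funext i
    rw [hw i, map_add, map_sum, map_sum, Finset.sum_eq_zero (s := Finset.univ)
      (f := fun k => π (Q' i k • κ k)) fun k _ => by rw [map_smul, hκ, smul_zero]]
    simp
  rw [h1, h2, smul_smul, mul_comm]

/-! ### Logarithmic derivatives -/

/-- The logarithmic derivative. -/
def dlog {K : Type} [Field K] [Algebra ℂ K] (x : K) : Ω[K⁄ℂ] :=
  x⁻¹ • KaehlerDifferential.D ℂ K x

section dlog

variable {K : Type} [Field K] [Algebra ℂ K]

theorem smul_dlog {x : K} (hx : x ≠ 0) : x • dlog x = KaehlerDifferential.D ℂ K x := by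
  rw [dlog, smul_smul, mul_inv_cancel₀ hx, one_smul]

theorem dlog_one : dlog (1 : K) = 0 := by simp [dlog]

theorem dlog_mul {x y : K} (hx : x ≠ 0) (hy : y ≠ 0) : dlog (x * y) = dlog x + dlog y := by
  rw [dlog, Derivation.leibniz, smul_add, smul_smul, smul_smul, add_comm, dlog, dlog]
  congr 2 <;> field_simp

theorem dlog_zpow {x : K} (hx : x ≠ 0) (l : ℤ) : dlog (x ^ l) = (l : K) • dlog x := by
  rw [dlog, Derivation.leibniz_zpow, dlog, ← Int.cast_smul_eq_zsmul K, smul_smul, smul_smul,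
    smul_smul]
  congr 1
  rw [zpow_sub_one₀ hx]
  have := zpow_ne_zero l hx
  field_simp

theorem dlog_div {x y : K} (hx : x ≠ 0) (hy : y ≠ 0) : dlog (x / y) = dlog x - dlog y := by
  rw [div_eq_mul_inv, ← zpow_neg_one, dlog_mul hx (zpow_ne_zero _ hy), dlog_zpow hy]
  simp [sub_eq_add_neg]

theorem dlog_prod {ι : Type*} (s : Finset ι) (x : ι → K) (hx : ∀ i ∈ s, x i ≠ 0) :
    dlog (∏ i ∈ s, x i) = ∑ i ∈ s, dlog (x i) := by
  classical
  induction s using Finset.induction_on with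
  | empty => simp [dlog_one]
  | insert a s ha ih =>
    rw [Finset.prod_insert ha, Finset.sum_insert ha, dlog_mul (hx a (by simp))
      (Finset.prod_ne_zero_iff.2 fun i hi => hx i (by simp [hi])),
      ih fun i hi => hx i (by simp [hi])]

end dlog

end

noncomputable section

/-! ### Divisor classes and relations among the rays -/

namespace SmoothCompleteFan

variable {n R : ℕ} (Y : SmoothCompleteFan n R)

theorem span_range_ray : Submodule.span ℤ (Set.range Y.ray) = ⊤ := by
  obtain ⟨σ, hσ, -⟩ := Y.complete 0
  rw [eq_top_iff, ← Y.span_eq_top σ hσ]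
  refine Submodule.span_mono ?_
  rintro _ ⟨j, rfl⟩
  exact ⟨j, rfl⟩

/-- An effective divisor on a complete toric variety that is linearly equivalent to zero is
zero. -/
theorem eq_zero_of_nonneg (m : Module.Dual ℤ (Fin n → ℤ)) (hm : ∀ j, 0 ≤ m (Y.ray j)) (j : Fin R) :
    m (Y.ray j) = 0 := by
  let μ : (Fin n → ℝ) →ₗ[ℝ] ℝ := ∑ a, (m (Pi.single a 1) : ℝ) • LinearMap.proj a
  have hμ : ∀ v : Fin n → ℤ, μ (fun k => (v k : ℝ)) = (m v : ℝ) := by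
    intro v
    have hv : m v = ∑ a, v a * m (Pi.single a 1) := by
      conv_lhs => rw [← Finset.univ_sum_single v]
      rw [map_sum]
      refine Finset.sum_congr rfl fun a _ => ?_
      rw [← smul_eq_mul, ← map_smul, ← Pi.single_smul, smul_eq_mul, mul_one]
    rw [hv]
    simp [μ, mul_comm]
  -- The vector `-v_j` lies in some cone, on which `m` is non-negative; so `m` is non-positive on
  -- `v_j`.
  obtain ⟨σ, -, hσ⟩ := Y.complete (-fun k => (Y.ray j k : ℝ))
  have hle : ∀ z ∈ PointedCone.hull ℝ ((fun j k => (Y.ray j k : ℝ)) '' (σ : Set (Fin R))),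
      0 ≤ μ z := by
    intro z hz
    induction hz using Submodule.span_induction with
    | mem z hz =>
      obtain ⟨k, -, rfl⟩ := hz
      rw [hμ]
      exact_mod_cast hm k
    | zero => simp
    | add a b _ _ ha hb => rw [map_add]; exact add_nonneg ha hb
    | smul r a _ ha =>
      have : r • a = (r : ℝ) • a := rfl
      rw [this, map_smul]
      exact mul_nonneg r.2 ha
  have h1 := hle _ hσ
  rw [map_neg, hμ] at h1
  have h2 : (m (Y.ray j) : ℝ) ≤ 0 := by linarith
  exact le_antisymm (by exact_mod_cast h2) (hm j)

theorem exists_dual_of_divClass_eq {a b : Fin R → ℤ} (h : Y.divClass a = Y.divClass b) :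
    ∃ m : Module.Dual ℤ (Fin n → ℤ), ∀ j, m (Y.ray j) = a j - b j := by
  obtain ⟨m, hm⟩ := (Submodule.Quotient.eq _).1 h
  exact ⟨m, fun j => congrFun hm j⟩

theorem sum_D_eq (S : Finset (Fin R)) :
    ∑ j ∈ S, Y.D j = Y.divClass (fun j => if j ∈ S then 1 else 0) := by
  simp only [D, ← map_sum]
  congr 1
  ext j
  simp [Finset.sum_apply, Pi.single_apply]

/-- Non-zero elements of a field that satisfy the monomial relations given by the linear relations
among the rays, i.e. a point of the torus dual to `Y`. -/
structure IsDualPoint {K : Type} [Field K] (x : Fin R → K) : Prop where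
  ne_zero : ∀ j, x j ≠ 0
  relation : ∀ l : Fin R → ℤ, ∑ j, l j • Y.ray j = 0 → ∏ j, x j ^ l j = 1

/-- The ray generators as vectors over a field. -/
def rayOver (K : Type) [Field K] (j : Fin R) : Fin n → K := fun a => (Y.ray j a : K)

/-- The logarithmic derivative of monomials at a point of the dual torus. -/
theorem IsDualPoint.exists_dlog {Y : SmoothCompleteFan n R} {K : Type} [Field K] [Algebra ℂ K]
    {x : Fin R → K} (hx : Y.IsDualPoint x) :
    ∃ π : (Fin n → K) →ₗ[K] Ω[K⁄ℂ], ∀ j, π (Y.rayOver K j) = dlog (x j) := by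
  have hspan : ∀ a : Fin n, ∃ l : Fin R → ℤ, ∑ j, l j • Y.ray j = Pi.single a 1 := by
    intro a
    have : (Pi.single a 1 : Fin n → ℤ) ∈ Submodule.span ℤ (Set.range Y.ray) := by
      rw [Y.span_range_ray]; trivial
    exact (Submodule.mem_span_range_iff_exists_fun ℤ).1 this
  choose q hq using hspan
  refine ⟨∑ a, (LinearMap.proj a : (Fin n → K) →ₗ[K] K).smulRight (∑ k, (q a k : K) • dlog (x k)),
    fun j => ?_⟩
  -- The relation obtained by writing `v_j` in the standard basis and each basis vector in the rays.
  -- The corresponding monomial relation makes `π` independent of the chosen expressions `q`.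
  let l : Fin R → ℤ := fun k => ∑ a, Y.ray j a * q a k - if k = j then 1 else 0
  have hl : ∑ k, l k • Y.ray k = 0 := by
    have h1 : ∑ k, (∑ a, Y.ray j a * q a k) • Y.ray k = Y.ray j := by
      simp_rw [Finset.sum_smul, mul_smul]
      rw [Finset.sum_comm]
      simp_rw [← Finset.smul_sum, hq]
      ext b
      simp [Finset.sum_apply, Pi.single_apply]
    simp only [l, sub_smul, Finset.sum_sub_distrib, h1]
    simp
  have h := hx.relation l hl
  have h2 := congrArg dlog h
  rw [dlog_prod _ _ fun k _ => zpow_ne_zero _ (hx.ne_zero k), dlog_one] at h2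
  simp_rw [dlog_zpow (hx.ne_zero _)] at h2
  simp only [l, Int.cast_sub, Int.cast_sum, Int.cast_mul, Int.cast_ite, Int.cast_one,
    Int.cast_zero, sub_smul, Finset.sum_sub_distrib, ite_smul, one_smul, zero_smul,
    Finset.sum_ite_eq', Finset.mem_univ, if_true, sub_eq_zero] at h2
  rw [← h2]
  simp only [rayOver, LinearMap.sum_apply, LinearMap.smulRight_apply, LinearMap.proj_apply,
    Finset.smul_sum, smul_smul, Finset.sum_smul]
  rw [Finset.sum_comm]

end SmoothCompleteFan

/-! ### Comparison of two nef partitions by characters -/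

namespace NefPartition

variable {n R c : ℕ} {Y : SmoothCompleteFan n R} {L : Fin c → Y.Pic} (P P' : NefPartition Y L)

/-- The index of the set of the partition that contains a ray. -/
def blk (j : Fin R) : Fin (c + 1) := (P.existsUnique_mem j).choose

theorem mem_S_iff (j : Fin R) (i : Fin (c + 1)) : j ∈ P.S i ↔ P.blk j = i :=
  ⟨fun h => (P.existsUnique_mem j).unique (P.existsUnique_mem j).choose_spec.1 h,
    fun h => h ▸ (P.existsUnique_mem j).choose_spec.1⟩

theorem S_eq_filter (i : Fin (c + 1)) : P.S i = Finset.univ.filter fun j => P.blk j = i := by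
  ext j
  simp [P.mem_S_iff]

/-- For `i ≤ c` both blocks represent `L_i`, so their difference is principal. The last block
follows, since the indicators of all blocks add up to `1`. -/
theorem exists_dual_blk (i : Fin (c + 1)) : ∃ m : Module.Dual ℤ (Fin n → ℤ), ∀ j,
    m (Y.ray j) = (if P.blk j = i then 1 else 0) - (if P'.blk j = i then 1 else 0) := by
  have hc : ∀ i : Fin c, ∃ m : Module.Dual ℤ (Fin n → ℤ), ∀ j, m (Y.ray j) =
      (if P.blk j = i.castSucc then 1 else 0) - (if P'.blk j = i.castSucc then 1 else 0) := by
    intro i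
    have h := (P.sum_eq i).trans (P'.sum_eq i).symm
    rw [Y.sum_D_eq, Y.sum_D_eq] at h
    obtain ⟨m, hm⟩ := Y.exists_dual_of_divClass_eq h
    exact ⟨m, fun j => by simp only [hm j, mem_S_iff]⟩
  induction i using Fin.lastCases with
  | cast i => exact hc i
  | last =>
    choose m hm using hc
    refine ⟨-∑ i, m i, fun j => ?_⟩
    have key : ∀ b : Fin (c + 1), ∑ i : Fin c, (if b = i.castSucc then (1 : ℤ) else 0) =
        1 - if b = Fin.last c then 1 else 0 := by
      intro b
      have := Fin.sum_univ_castSucc fun i : Fin (c + 1) => if b = i then (1 : ℤ) else 0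
      rw [Finset.sum_ite_eq] at this
      simp only [Finset.mem_univ, if_true] at this
      linarith
    simp only [LinearMap.neg_apply, LinearMap.sum_apply, hm, Finset.sum_sub_distrib, key]
    ring

/-- The blocks in `I` of the two partitions form linearly equivalent divisors, and by `hI` one
contains the other. The difference is effective and principal, hence zero. This is the balance of
the digraph with edges from `P.blk j` to `P'.blk j`. -/
theorem blk_mem_of_forall (I : Finset (Fin (c + 1)))
    (hI : ∀ j, P.blk j ∈ I → P'.blk j ∈ I) (j : Fin R) (hj : P'.blk j ∈ I) : P.blk j ∈ I := by
  choose m hm using P'.exists_dual_blk P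
  have hsum : ∀ j, (∑ i ∈ I, m i) (Y.ray j) =
      (if P'.blk j ∈ I then 1 else 0) - (if P.blk j ∈ I then 1 else 0) := by
    intro j
    simp [LinearMap.sum_apply, hm]
  have h0 := Y.eq_zero_of_nonneg (∑ i ∈ I, m i) (fun j => by
    rw [hsum]
    by_cases h : P.blk j ∈ I
    · simp [h, hI j h]
    · simp only [h, if_false, sub_zero]
      split_ifs <;> simp) j
  rw [hsum, if_pos hj] at h0
  by_contra h
  simp [h] at h0

end NefPartition

/-! ### Rays outside `E` as a basis of the lattice -/

namespace PrzyjalkowskiChoice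

variable {n R c : ℕ} {Y : SmoothCompleteFan n R} {L : Fin c → Y.Pic} {P : NefPartition Y L}
  (d : PrzyjalkowskiChoice P)

theorem blk_s (i : Fin c) : P.blk (d.s i) = i.castSucc := (P.mem_S_iff _ _).1 (d.s_mem i)

theorem blk_of_mem_E {b : Fin R} (hb : b ∈ d.E) : P.blk b = Fin.last c :=
  (P.mem_S_iff _ _).1 (d.E_subset hb)

theorem s_notMem_E (i : Fin c) : d.s i ∉ d.E := fun h =>
  (Fin.castSucc_lt_last i).ne ((d.blk_s i).symm.trans (d.blk_of_mem_E h))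

/-- The functional on the Picard group given by a relation among the rays. -/
theorem exists_functional (l : Fin R → ℤ) (hl : ∑ j, l j • Y.ray j = 0) :
    ∃ μ : Y.Pic →ₗ[ℤ] ℤ, ∀ j, μ (Y.D j) = l j := by
  let μ0 : (Fin R → ℤ) →ₗ[ℤ] ℤ := ∑ j, l j • LinearMap.proj j
  have hμ0 : LinearMap.range Y.rhoDual ≤ LinearMap.ker μ0 := by
    rintro _ ⟨m, rfl⟩
    have h2 := congrArg m hl
    simp only [map_sum, map_smul, map_zero] at h2
    simpa [μ0, SmoothCompleteFan.rhoDual] using h2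
  refine ⟨(LinearMap.range Y.rhoDual).liftQ μ0 hμ0, fun j => ?_⟩
  have : (LinearMap.range Y.rhoDual).liftQ μ0 hμ0 (Y.D j) = μ0 (Pi.single j 1) := rfl
  rw [this]
  simp [μ0, Pi.single_apply]

theorem relation_eq_zero (l : Fin R → ℤ) (hl : ∑ j, l j • Y.ray j = 0)
    (hE : ∀ b ∈ d.E, l b = 0) : l = 0 := by
  obtain ⟨μ, hμ⟩ := exists_functional l hl
  have : μ = 0 := by
    refine LinearMap.ext_on d.span_eq_top ?_
    rintro _ ⟨b, rfl⟩
    rw [hμ, hE b b.2, LinearMap.zero_apply]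
  ext j
  rw [← hμ j, this]
  rfl

/-- Relations among the rays are the functionals on `Pic(Y)`; the one wanted is the coordinate
function of `D_b` in the basis `E`. -/
theorem exists_relation {b : Fin R} (hb : b ∈ d.E) : ∃ l : Fin R → ℤ,
    ∑ j, l j • Y.ray j = 0 ∧ l b = 1 ∧ ∀ b' ∈ d.E, b' ≠ b → l b' = 0 := by
  let B : Module.Basis d.E ℤ Y.Pic := Module.Basis.mk d.linearIndependent d.span_eq_top.ge
  have hB : ∀ b, B b = Y.D b := fun b => by simp [B]
  let μ := B.coord ⟨b, hb⟩
  refine ⟨fun j => μ (Y.D j), ?_, ?_, ?_⟩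
  · refine (Module.forall_dual_apply_eq_zero_iff ℤ _).1 fun m => ?_
    have h1 : ∑ j, m (Y.ray j) • Y.D j = Y.divClass (Y.rhoDual m) := by
      simp only [SmoothCompleteFan.D, ← map_smul, ← map_sum]
      congr 1
      ext j
      simp [Pi.single_apply, SmoothCompleteFan.rhoDual]
    have h2 : Y.divClass (Y.rhoDual m) = 0 :=
      (Submodule.Quotient.mk_eq_zero _).2 (LinearMap.mem_range_self _ m)
    have h3 := congrArg μ (h1.trans h2)
    simp only [map_sum, map_smul, map_zero] at h3 ⊢
    rw [← h3]
    exact Finset.sum_congr rfl fun j _ => by simp [mul_comm]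
  · have := hB ⟨b, hb⟩
    simp only at this
    simp [μ, ← this]
  · intro b' hb' hne
    have := hB ⟨b', hb'⟩
    simp only at this
    simp only [μ, ← this, Module.Basis.coord_apply, Module.Basis.repr_self]
    exact Finsupp.single_eq_of_ne fun h => hne (congrArg Subtype.val h).symm

theorem exists_eq_prod {b : Fin R} (hb : b ∈ d.E) : ∃ l : Fin R → ℤ,
    ∀ {K : Type} [Field K] (x : Fin R → K), Y.IsDualPoint x → x b = ∏ k ∈ d.Eᶜ, x k ^ l k := by
  obtain ⟨l, hl, hlb, hlE⟩ := d.exists_relation hb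
  refine ⟨fun k => -l k, fun {K} _ x hx => ?_⟩
  have h := hx.relation l hl
  rw [← Finset.prod_mul_prod_compl d.E, Finset.prod_eq_single b, hlb, zpow_one] at h
  · simp_rw [zpow_neg]
    rw [Finset.prod_inv_distrib]
    exact eq_inv_of_mul_eq_one_left h
  · intro b' hb' hne
    rw [hlE b' hb' hne, zpow_zero]
  · exact fun h => absurd hb h

/-- The rays outside `E`, indexed by the variables and the elements `s_i`. -/
def freeRay : d.Var ⊕ Fin c → Fin R := Sum.elim Subtype.val d.s

theorem freeRay_injective : Function.Injective d.freeRay := by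
  refine Function.Injective.sumElim Subtype.val_injective ?_ ?_
  · intro i i' h
    have h' := congrArg P.blk h
    rw [d.blk_s, d.blk_s] at h'
    exact Fin.castSucc_injective _ h'
  · intro j i
    exact j.2.2 i

theorem freeRay_notMem (k : d.Var ⊕ Fin c) : d.freeRay k ∉ d.E := by
  rcases k with j | i
  · exact j.2.1
  · exact d.s_notMem_E i

theorem exists_freeRay {j : Fin R} (hj : j ∉ d.E) : ∃ k, d.freeRay k = j := by
  by_cases h : ∀ i, j ≠ d.s i
  · exact ⟨Sum.inl ⟨j, hj, h⟩, rfl⟩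
  · push Not at h
    obtain ⟨i, hi⟩ := h
    exact ⟨Sum.inr i, hi.symm⟩

instance : Fintype d.Var := Fintype.ofFinite _

theorem linearIndependent_freeRay : LinearIndependent ℤ fun k => Y.ray (d.freeRay k) := by
  classical
  rw [Fintype.linearIndependent_iff]
  intro g hg
  let l : Fin R → ℤ := fun j => ∑ k, if d.freeRay k = j then g k else 0
  have hlk : ∀ k, l (d.freeRay k) = g k := by
    intro k
    simp only [l, d.freeRay_injective.eq_iff]
    rw [Finset.sum_ite_eq' Finset.univ k g, if_pos (Finset.mem_univ k)]
  have hl : ∑ j, l j • Y.ray j = 0 := by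
    rw [← hg]
    simp only [l, Finset.sum_smul, ite_smul, zero_smul]
    rw [Finset.sum_comm]
    simp
  have h0 := d.relation_eq_zero l hl fun b hb =>
    Finset.sum_eq_zero fun k _ => if_neg fun h : d.freeRay k = b => d.freeRay_notMem k (h ▸ hb)
  intro k
  rw [← hlk, h0]
  rfl

/-- Gale duality: as the classes of `E` form a basis of `Pic(Y)`, the complementary rays form a
basis of `N`. The relation dual to `b ∈ E` expresses `v_b` in the rays outside `E`. -/
theorem span_freeRay : Submodule.span ℤ (Set.range fun k => Y.ray (d.freeRay k)) = ⊤ := by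
  have hmem : ∀ j ∉ d.E, Y.ray j ∈ Submodule.span ℤ (Set.range fun k => Y.ray (d.freeRay k)) := by
    intro j hj
    obtain ⟨k, rfl⟩ := d.exists_freeRay hj
    exact Submodule.subset_span ⟨k, rfl⟩
  rw [eq_top_iff, ← Y.span_range_ray, Submodule.span_le]
  rintro _ ⟨j, rfl⟩
  by_cases hj : j ∈ d.E
  · obtain ⟨l, hl, hlb, hlE⟩ := d.exists_relation hj
    rw [← Finset.sum_add_sum_compl d.E, Finset.sum_eq_single j, hlb, one_smul] at hl
    · rw [eq_neg_of_add_eq_zero_left hl]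
      exact neg_mem (sum_mem fun k hk =>
        Submodule.smul_mem _ _ (hmem k (Finset.mem_compl.1 hk)))
    · intro b' hb' hne
      rw [hlE b' hb' hne, zero_smul]
    · exact fun h => absurd hj h
  · exact hmem j hj

theorem card_var_add : Nat.card d.Var + c = n := by
  have b := Module.Basis.mk d.linearIndependent_freeRay d.span_freeRay.ge
  have h := Module.finrank_eq_nat_card_basis b
  rw [Module.finrank_fin_fun, Nat.card_sum, Nat.card_fin] at h
  exact h.symm

/-- The determinant is that of a `ℤ`-basis of `N`, so it is already a unit in `ℤ`. -/
theorem det_rayOver {m : ℕ} (K : Type) [Field K] (e : Fin m ≃ d.Var) (τ : Fin n ≃ Fin m ⊕ Fin c) :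
    ((Pi.basisFun K (Fin n)).reindex τ).det
        (Sum.elim (fun i => Y.rayOver K (e i)) (fun i => Y.rayOver K (d.s i))) = 1 ∨
      ((Pi.basisFun K (Fin n)).reindex τ).det
        (Sum.elim (fun i => Y.rayOver K (e i)) (fun i => Y.rayOver K (d.s i))) = -1 := by
  let e' : Fin m ⊕ Fin c ≃ d.Var ⊕ Fin c := Equiv.sumCongr e (Equiv.refl _)
  let fam : Fin m ⊕ Fin c → Fin n → ℤ := fun k => Y.ray (d.freeRay (e' k))
  have hu : IsUnit (((Pi.basisFun ℤ (Fin n)).reindex τ).det fam) := by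
    rw [← Module.Basis.is_basis_iff_det]
    refine ⟨d.linearIndependent_freeRay.comp e' e'.injective, ?_⟩
    rw [← d.span_freeRay]
    congr 1
    exact e'.surjective.range_comp fun k => Y.ray (d.freeRay k)
  have hcast : ((Pi.basisFun K (Fin n)).reindex τ).det
      (Sum.elim (fun i => Y.rayOver K (e i)) (fun i => Y.rayOver K (d.s i))) =
      (((Pi.basisFun ℤ (Fin n)).reindex τ).det fam : ℤ) := by
    rw [Module.Basis.det_apply, Module.Basis.det_apply, Int.cast_det]
    congr 1
    ext i k
    rcases k with k | k <;>
    simp [Module.Basis.toMatrix_apply, fam, e', freeRay, SmoothCompleteFan.rayOver]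
  rw [hcast]
  rcases Int.isUnit_iff.1 hu with h | h <;> simp [h]

end PrzyjalkowskiChoice

end

noncomputable section

/-! ### Exchange of the block sums of two partitions -/

/-- Let `b` and `b'` be two partitions of an index set `ι` into blocks indexed by `V`.  An exchange
is a rescaling `x j ↦ x j * h (b j) / h (b' j)` after which the sums over the blocks of `b'` are
the sums of `x` over the blocks of `b`.  The set `ν` consists of the blocks where `h` is not
normalized to be `1`, and the linear system for `h` is regular. -/
structure Exchange {ι V K : Type} [Fintype ι] [Fintype V] [DecidableEq V] [Field K]
    (b b' : ι → V) (x : ι → K) where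
  h : V → K
  h_ne_zero : ∀ i, h i ≠ 0
  ν : Finset V
  h_eq_one : ∀ i ∉ ν, h i = 1
  sum_eq : ∀ k, ∑ j, (if b' j = k then x j * h (b j) / h (b' j) else 0) =
    ∑ j, if b j = k then x j else 0
  det_ne_zero : (Matrix.of fun k i : ν =>
    ∑ j, (if b j = i ∧ b' j = k then x j * h (b j) / h (b' j) else 0) -
      if k = i then ∑ j, (if b j = k then x j else 0) else 0).det ≠ 0
  component : ∀ ρ ∉ ν, ∃ I : Finset V, ρ ∈ I ∧ (∀ i ∈ I, i ≠ ρ → i ∈ ν) ∧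
    ∀ j, b j ∈ I ↔ b' j ∈ I

section

variable {ι V K W : Type} [Fintype ι] [Fintype V] [DecidableEq V] [Field K] {b b' : ι → V}
  {x : ι → K} [AddCommGroup W] [Module K W]

theorem sum_ite_and_mul (x : ι → K) (θ : V → K) (k : V) :
    ∑ i, (∑ j, if b j = i ∧ b' j = k then x j else 0) * θ i =
      ∑ j, if b' j = k then x j * θ (b j) else 0 := by
  simp_rw [Finset.sum_mul]
  rw [Finset.sum_comm]
  refine Finset.sum_congr rfl fun j _ => ?_
  by_cases h : b' j = k <;> simp [h]

theorem sum_ite_and (x : ι → K) (k : V) :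
    ∑ l, (∑ j, if b j = k ∧ b' j = l then x j else 0) = ∑ j, if b j = k then x j else 0 := by
  rw [Finset.sum_comm]
  refine Finset.sum_congr rfl fun j _ => ?_
  by_cases h : b j = k <;> simp [h]

/-- The factors are the harmonic vector of the digraph with weight `X i k`, the sum of the `x j`
with `b j = i` and `b' j = k`. Hypothesis `hb` is its balance. -/
theorem Exchange.nonempty (C : PositiveSystem K) (hx : ∀ j, x j ∈ C.carrier)
    (hb : ∀ I : Finset V, (∀ j, b j ∈ I → b' j ∈ I) → ∀ j, b' j ∈ I → b j ∈ I) :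
    Nonempty (Exchange b b' x) := by
  let X : V → V → K := fun i k => ∑ j, if b j = i ∧ b' j = k then x j else 0
  have hterm : ∀ i k, ∀ j ∈ Finset.univ, (if b j = i ∧ b' j = k then x j else 0) = 0 ∨
      (if b j = i ∧ b' j = k then x j else 0) ∈ C.carrier := by
    intro i k j _
    split_ifs
    · exact Or.inr (hx j)
    · exact Or.inl rfl
  have hX : ∀ i k, X i k = 0 ∨ X i k ∈ C.carrier := fun i k =>
    C.sum_mem_or _ _ (hterm i k)
  have hX0 : ∀ j, X (b j) (b' j) ≠ 0 := fun j h => by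
    have := C.sum_eq_zero _ _ (hterm _ _) h j (Finset.mem_univ j)
    rw [if_pos ⟨rfl, rfl⟩] at this
    exact C.ne_zero (hx j) this
  have hX0' : ∀ i k, (∀ j, b j = i → b' j ≠ k) → X i k = 0 := fun i k h =>
    Finset.sum_eq_zero fun j _ => if_neg fun hj => h j hj.1 hj.2
  obtain ⟨ν, h, -, hpos, hone, hharm, huniq, hcomp⟩ := exists_harmonic C Finset.univ X
    (fun i _ k _ => hX i k) (by
      intro I _ hcl i hi k _ hk
      refine hX0' k i fun j hjk hji => hk (hjk ▸ ?_)
      refine hb I (fun j hj => ?_) j (hji ▸ hi)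
      by_contra hj'
      exact hX0 j (hcl _ hj _ (Finset.mem_univ _) hj'))
  have hne : ∀ i, h i ≠ 0 := fun i => C.ne_zero (hpos i (Finset.mem_univ i))
  have hharm' : ∀ k, ∑ j, (if b' j = k then x j * h (b j) else 0) =
      (∑ j, if b j = k then x j else 0) * h k := by
    intro k
    rw [← sum_ite_and_mul, hharm k (Finset.mem_univ k), sum_ite_and]
  refine ⟨h, hne, ν, fun i hi => hone i (Finset.mem_univ i) hi, ?_, ?_, ?_⟩
  · intro k
    rw [eq_div_of_mul_eq (hne k) (hharm' k).symm, Finset.sum_div]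
    refine Finset.sum_congr rfl fun j _ => ?_
    split_ifs with hj
    · rw [hj]
    · simp
  · intro hdet
    obtain ⟨v, hv0, hv⟩ := Matrix.exists_mulVec_eq_zero_iff.2 hdet
    -- A kernel vector of the matrix of the rescaled variables, multiplied by `h`, solves the
    -- original system with value zero at the roots; so it vanishes.
    let θ : V → K := fun i => if hi : i ∈ ν then h i * v ⟨i, hi⟩ else 0
    have hθ : ∀ i : ν, θ i = h i * v i := fun i => by simp [θ]
    refine hv0 (funext fun i => ?_)
    have h0 : θ i = 0 := huniq θ (fun i _ hi => dif_neg hi) (fun k hk => ?_) i (Finset.mem_univ _)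
    · rw [hθ] at h0
      exact (mul_eq_zero.1 h0).resolve_left (hne i)
    · have hrow := congrFun hv ⟨k, hk⟩
      have hent : ∀ i : ν, ∑ j, (if b j = i ∧ b' j = k then x j * h (b j) / h (b' j) else 0) =
          X i k * h i / h k := by
        intro i
        simp only [X, Finset.sum_mul, Finset.sum_div]
        refine Finset.sum_congr rfl fun j _ => ?_
        split_ifs with hj
        · rw [hj.1, hj.2]
        · simp
      simp only [Matrix.mulVec, dotProduct, Matrix.of_apply, hent, sub_mul, Pi.zero_apply,
        Finset.sum_sub_distrib, ite_mul, zero_mul, Finset.sum_ite_eq, Finset.mem_univ,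
        if_true, sub_eq_zero] at hrow
      have hsum : ∑ i, X i k * θ i = ∑ i : ν, X i k * (h i * v i) := by
        rw [← Finset.sum_subset (Finset.subset_univ ν) fun i _ hi => by
          rw [show θ i = 0 from dif_neg hi, mul_zero], ← Finset.sum_coe_sort ν]
        exact Finset.sum_congr rfl fun i _ => by rw [hθ]
      have hrow' : ∑ i : ν, X i k * (h i * v i) =
          h k * ∑ i : ν, X i k * h i / h k * v i := by
        rw [Finset.mul_sum]
        refine Finset.sum_congr rfl fun i _ => ?_
        have := hne k
        field_simp
      rw [hsum, hrow', hrow, hθ ⟨k, hk⟩, sum_ite_and]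
      ring
  · intro ρ hρ
    obtain ⟨I, -, hρI, hIν, hI⟩ := hcomp ρ (Finset.mem_univ ρ) hρ
    refine ⟨I, hρI, hIν, fun j => ⟨fun hj => ?_, fun hj => ?_⟩⟩
    · by_contra hj'
      exact hX0 j (hI _ hj _ (Finset.mem_univ _) hj').1
    · by_contra hj'
      exact hX0 j (hI _ hj _ (Finset.mem_univ _) hj').2

/-! ### Linearization of an exchange, its determinant, and recovery of the scaling factors -/

namespace Exchange

variable (χ : Exchange b b' x)

/-- The rescaled variables. -/
def tilde (j : ι) : K := x j * χ.h (b j) / χ.h (b' j)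

/-- The matrix of the linear system for the scaling factors. -/
def lap : Matrix χ.ν χ.ν K := Matrix.of fun k i =>
  ∑ j, (if b j = i ∧ b' j = k then χ.tilde j else 0) -
    if k = i then ∑ j, (if b j = k then x j else 0) else 0

theorem lap_det_ne_zero : χ.lap.det ≠ 0 := χ.det_ne_zero

theorem sum_tilde (k : V) :
    ∑ j, (if b' j = k then χ.tilde j else 0) = ∑ j, if b j = k then x j else 0 := χ.sum_eq k

theorem sum_tilde_univ : ∑ j, χ.tilde j = ∑ j, x j := by
  have h : ∀ (β : ι → V) (y : ι → K), ∑ j, y j = ∑ k, ∑ j, if β j = k then y j else 0 := by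
    intro β y
    rw [Finset.sum_comm]
    simp
  rw [h b', h b]
  exact Finset.sum_congr rfl fun k _ => χ.sum_tilde k

theorem tilde_ne_zero (hx : ∀ j, x j ≠ 0) (j : ι) : χ.tilde j ≠ 0 :=
  div_ne_zero (mul_ne_zero (hx j) (χ.h_ne_zero _)) (χ.h_ne_zero _)

/-- Here `t j` stands for the logarithmic derivative of `x j` and `η i` for that of `h i`, so `t j +
η (b j) - η k` is that of `χ.tilde j` when `b' j = k`. The part that is linear in `η` is governed by
`χ.lap`. -/
theorem lap_row (t : ι → W) (η : V → W) (hη : ∀ i ∉ χ.ν, η i = 0) (k : χ.ν) :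
    ∑ j, (if b' j = k then χ.tilde j • (t j + η (b j) - η k) else 0) =
      ∑ j, (if b' j = k then χ.tilde j • t j else 0) + ∑ i, χ.lap k i • η i := by
  have h1 : ∑ i, χ.lap k i • η i = ∑ j, (if b' j = k then χ.tilde j • η (b j) else 0) -
      ∑ j, (if b' j = k then χ.tilde j • η k else 0) := by
    have h2 : ∑ j, (if b' j = k then χ.tilde j • η k else 0) =
        (∑ j, if b j = k then x j else 0) • η k := by
      rw [← χ.sum_tilde, Finset.sum_smul]
      exact Finset.sum_congr rfl fun j _ => by split_ifs <;> simp
    rw [h2]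
    simp only [lap, Matrix.of_apply, sub_smul, Finset.sum_sub_distrib, ite_smul, zero_smul,
      Finset.sum_ite_eq, Finset.mem_univ, if_true]
    congr 1
    rw [Finset.sum_coe_sort χ.ν fun i : V =>
        (∑ j, if b j = i ∧ b' j = k then χ.tilde j else 0) • η i,
      Finset.sum_subset (Finset.subset_univ χ.ν) fun i _ hi => by rw [hη i hi, smul_zero]]
    simp_rw [Finset.sum_smul]
    rw [Finset.sum_comm]
    refine Finset.sum_congr rfl fun j _ => ?_
    by_cases h : b' j = k <;> simp [h, ite_smul]
  rw [h1, ← Finset.sum_sub_distrib, ← Finset.sum_add_distrib]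
  refine Finset.sum_congr rfl fun j _ => ?_
  split_ifs
  · rw [smul_sub, smul_add]
    abel
  · simp

/-- The linearization of the exchange at `x` in the direction `t`. -/
theorem exists_linearization (t : ι → W) : ∃ η : V → W, (∀ i ∉ χ.ν, η i = 0) ∧
    ∀ k, ∑ j, (if b' j = k then χ.tilde j • (t j + η (b j) - η k) else 0) =
      ∑ j, if b j = k then x j • t j else 0 := by
  let rhs : χ.ν → W := fun k => ∑ j, (if b j = k then x j • t j else 0) -
    ∑ j, (if b' j = k then χ.tilde j • t j else 0)
  let η : V → W := fun i => if hi : i ∈ χ.ν then ∑ k, χ.lap⁻¹ ⟨i, hi⟩ k • rhs k else 0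
  have hη : ∀ i ∉ χ.ν, η i = 0 := fun i hi => dif_neg hi
  have hην : ∀ i : χ.ν, η i = ∑ k, χ.lap⁻¹ i k • rhs k := fun i => by simp [η]
  have hrow : ∀ k ∈ χ.ν, ∑ j, (if b' j = k then χ.tilde j • (t j + η (b j) - η k) else 0) =
      ∑ j, if b j = k then x j • t j else 0 := by
    intro k hk
    have h1 := χ.lap_row t η hη ⟨k, hk⟩
    have h2 : ∑ i, χ.lap ⟨k, hk⟩ i • η i = rhs ⟨k, hk⟩ := by
      simp_rw [hην, Finset.smul_sum, smul_smul]
      rw [Finset.sum_comm]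
      simp_rw [← Finset.sum_smul, ← Matrix.mul_apply]
      rw [Matrix.mul_nonsing_inv _ χ.lap_det_ne_zero.isUnit]
      simp [Matrix.one_apply, ite_smul]
    rw [h2] at h1
    simpa [rhs] using h1
  refine ⟨η, hη, fun k => ?_⟩
  by_cases hk : k ∈ χ.ν
  · exact hrow k hk
  -- The equation at a root is not imposed by `χ.lap`. Weighted by `h`, the errors `E` over a
  -- component cancel for every `η`. All errors but the one at the root are zero, so that one is
  -- zero too.
  obtain ⟨I, hkI, hIν, hI⟩ := χ.component k hk
  let E : V → W := fun k => ∑ j, (if b' j = k then χ.tilde j • (t j + η (b j) - η k) else 0) -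
    ∑ j, if b j = k then x j • t j else 0
  have hsum : ∀ (β : ι → V) (f : ι → V → W),
      ∑ k ∈ I, ∑ j, (if β j = k then f j k else 0) =
        ∑ j, if β j ∈ I then f j (β j) else 0 := by
    intro β f
    rw [Finset.sum_comm]
    refine Finset.sum_congr rfl fun j _ => ?_
    rw [Finset.sum_ite_eq]
  have hEsum : ∑ k ∈ I, χ.h k • E k = 0 := by
    have h1 : ∀ k, χ.h k • E k =
        ∑ j, (if b' j = k then (x j * χ.h (b j)) • (t j + η (b j) - η k) else 0) -
        ∑ j, (if b j = k then (χ.h k * x j) • t j else 0) := by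
      intro k
      simp only [E, smul_sub (χ.h k), Finset.smul_sum]
      congr 1
      · refine Finset.sum_congr rfl fun j _ => ?_
        split_ifs with hj
        · rw [smul_smul]
          congr 1
          have := χ.h_ne_zero k
          rw [tilde, hj]
          field_simp
        · rw [smul_zero]
      · refine Finset.sum_congr rfl fun j _ => ?_
        split_ifs
        · rw [smul_smul]
        · rw [smul_zero]
    have h2 : ∀ k, ∑ j, (if b' j = k then (x j * χ.h (b j)) • η k else 0) =
        ∑ j, (if b j = k then (x j * χ.h k) • η k else 0) := by
      intro k
      have e1 : ∑ j, (if b' j = k then (x j * χ.h (b j)) • η k else 0) =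
          (χ.h k * ∑ j, if b' j = k then χ.tilde j else 0) • η k := by
        rw [Finset.mul_sum, Finset.sum_smul]
        refine Finset.sum_congr rfl fun j _ => ?_
        split_ifs with hj
        · congr 1
          have := χ.h_ne_zero k
          rw [tilde, hj]
          field_simp
        · simp
      have e2 : ∑ j, (if b j = k then (x j * χ.h k) • η k else 0) =
          (χ.h k * ∑ j, if b j = k then x j else 0) • η k := by
        rw [Finset.mul_sum, Finset.sum_smul]
        refine Finset.sum_congr rfl fun j _ => ?_
        split_ifs with hj
        · rw [mul_comm]
        · simp
      rw [e1, e2, χ.sum_tilde]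
    have h3 : ∑ j, (if b' j ∈ I then (x j * χ.h (b j)) • η (b' j) else 0) =
        ∑ j, (if b j ∈ I then (x j * χ.h (b j)) • η (b j) else 0) := by
      rw [← hsum b' fun j k => (x j * χ.h (b j)) • η k, ← hsum b fun j k => (x j * χ.h k) • η k]
      exact Finset.sum_congr rfl fun k _ => h2 k
    simp_rw [h1]
    rw [Finset.sum_sub_distrib, hsum b' fun j k => (x j * χ.h (b j)) • (t j + η (b j) - η k),
      hsum b fun j k => (χ.h k * x j) • t j]
    rw [← sub_eq_zero.2 h3.symm, ← Finset.sum_sub_distrib, ← Finset.sum_sub_distrib]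
    refine Finset.sum_congr rfl fun j _ => ?_
    by_cases hj : b j ∈ I
    · rw [if_pos hj, if_pos ((hI j).1 hj), if_pos hj, if_pos ((hI j).1 hj), smul_sub, smul_add,
        mul_comm (χ.h (b j))]
      abel
    · have hj' : b' j ∉ I := fun h => hj ((hI j).2 h)
      simp [hj, hj']
  rw [Finset.sum_eq_single k (fun i hi hik => by
      rw [show E i = 0 from sub_eq_zero.2 (hrow i (hIν i hi hik)), smul_zero])
    (fun h => absurd hkI h)] at hEsum
  exact sub_eq_zero.1 ((smul_eq_zero.1 hEsum).resolve_left (χ.h_ne_zero k))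

theorem linearization_unique (t : ι → W) (η η' : V → W) (hη : ∀ i ∉ χ.ν, η i = 0)
    (hη' : ∀ i ∉ χ.ν, η' i = 0)
    (h : ∀ k, ∑ j, (if b' j = k then χ.tilde j • (t j + η (b j) - η k) else 0) =
      ∑ j, if b j = k then x j • t j else 0)
    (h' : ∀ k, ∑ j, (if b' j = k then χ.tilde j • (t j + η' (b j) - η' k) else 0) =
      ∑ j, if b j = k then x j • t j else 0) (i : V) : η i = η' i := by
  by_cases hi : i ∈ χ.ν
  · have hrow : ∀ k : χ.ν, ∑ i, χ.lap k i • (η i - η' i) = 0 := by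
      intro k
      have h1 := (χ.lap_row t η hη k).symm.trans ((h k).trans (h' k).symm)
      rw [χ.lap_row t η' hη' k] at h1
      simp_rw [smul_sub]
      rw [Finset.sum_sub_distrib, add_left_cancel h1, sub_self]
    have : η i - η' i = ∑ k, χ.lap⁻¹ ⟨i, hi⟩ k • ∑ i, χ.lap k i • (η i - η' i) := by
      simp_rw [Finset.smul_sum, smul_smul]
      rw [Finset.sum_comm]
      simp_rw [← Finset.sum_smul, ← Matrix.mul_apply]
      rw [Matrix.nonsing_inv_mul _ χ.lap_det_ne_zero.isUnit]
      simp [Matrix.one_apply, ite_smul]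
    rw [← sub_eq_zero, this]
    exact Finset.sum_eq_zero fun k _ => by rw [hrow, smul_zero]
  · rw [hη i hi, hη' i hi]

/-- The determinant of the linearization of an exchange. -/
theorem det_linearization (t : ι → W) (η : V → W) (hη : ∀ i ∉ χ.ν, η i = 0)
    (h : ∀ k, ∑ j, (if b' j = k then χ.tilde j • (t j + η (b j) - η k) else 0) =
      ∑ j, if b j = k then x j • t j else 0)
    (m : V → W →ₗ[K] K)
    (hm : ∀ i j, m i (t j) = (if b j = i then 1 else 0) - (if b' j = i then 1 else 0)) :
    (1 + Matrix.of fun l i : χ.ν => m l (η i)).det = (-1) ^ χ.ν.card := by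
  let N : Matrix χ.ν χ.ν K := Matrix.of fun l i => m l (η i)
  -- The Laplacian of the original weights, transposed relative to `χ.lap`. Applying the functionals
  -- `m l` to the linearized equations turns the terms in `t` into entries of the two Laplacians;
  -- the diagonal parts that remain give `hAB`.
  let B : Matrix χ.ν χ.ν K := Matrix.of fun k l =>
    ∑ j, (if b j = k ∧ b' j = l then x j else 0) -
      if k = l then ∑ j, (if b j = k then x j else 0) else 0
  have hAB : χ.lap * (1 + N.transpose) = -B := by
    ext k l
    have h1 := (χ.lap_row t η hη k).symm.trans (h k)
    have h2 := congrArg (m l) h1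
    have e1 : m l (∑ j, if b' j = k then χ.tilde j • t j else 0) =
        ∑ j, (if b j = l ∧ b' j = k then χ.tilde j else 0) -
          if k = l then ∑ j, (if b j = k then x j else 0) else 0 := by
      have : (if k = l then ∑ j, (if b j = k then x j else 0) else 0) =
          ∑ j, if b' j = k then (if k = l then χ.tilde j else 0) else 0 := by
        rw [← χ.sum_tilde]
        split_ifs <;> simp
      rw [this, map_sum, ← Finset.sum_sub_distrib]
      refine Finset.sum_congr rfl fun j _ => ?_
      by_cases hj : b' j = k
      · simp only [hj, if_true, map_smul, hm, smul_eq_mul, Subtype.ext_iff, and_true]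
        split_ifs <;> simp
      · simp [hj]
    have e2 : m l (∑ j, if b j = k then x j • t j else 0) =
        (if k = l then ∑ j, (if b j = k then x j else 0) else 0) -
        ∑ j, (if b j = k ∧ b' j = l then x j else 0) := by
      have : (if k = l then ∑ j, (if b j = k then x j else 0) else 0) =
          ∑ j, if b j = k then (if k = l then x j else 0) else 0 := by
        split_ifs <;> simp
      rw [this, map_sum, ← Finset.sum_sub_distrib]
      refine Finset.sum_congr rfl fun j _ => ?_
      by_cases hj : b j = k
      · simp only [hj, if_true, map_smul, hm, smul_eq_mul, Subtype.ext_iff, true_and]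
        split_ifs <;> simp
      · simp [hj]
    rw [map_add, e1, e2, map_sum] at h2
    simp only [map_smul, smul_eq_mul] at h2
    rw [mul_add, mul_one, Matrix.add_apply, Matrix.mul_apply, Matrix.neg_apply]
    simp only [N, B, lap, Matrix.transpose_apply, Matrix.of_apply] at h2 ⊢
    rw [h2]
    ring
  have hB : B.det = χ.lap.det := by
    -- Between blocks `k` and `l` the exchange multiplies every weight by the same factor `h k / h
    -- l`.
    have hconj : B = Matrix.diagonal (fun k : χ.ν => (χ.h k)⁻¹) * χ.lap.transpose *
        Matrix.diagonal (fun k : χ.ν => χ.h k) := by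
      ext k l
      rw [Matrix.mul_diagonal, Matrix.diagonal_mul, Matrix.transpose_apply]
      simp only [B, lap, Matrix.of_apply]
      rw [mul_sub, sub_mul]
      congr 1
      · rw [Finset.mul_sum, Finset.sum_mul]
        refine Finset.sum_congr rfl fun j _ => ?_
        split_ifs with hj
        · have h1 := χ.h_ne_zero k
          have h2 := χ.h_ne_zero l
          rw [tilde, hj.1, hj.2]
          field_simp
        · simp
      · by_cases hkl : k = l
        · subst hkl
          have h1 := χ.h_ne_zero k
          simp only [if_true]
          field_simp
        · simp [hkl, Ne.symm hkl]
    rw [hconj, Matrix.det_mul, Matrix.det_mul, Matrix.det_diagonal, Matrix.det_diagonal,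
      Matrix.det_transpose, Finset.prod_inv_distrib]
    have : ∏ k : χ.ν, χ.h k ≠ 0 := Finset.prod_ne_zero_iff.2 fun k _ => χ.h_ne_zero k
    field_simp
  have hdet := congrArg Matrix.det hAB
  rw [Matrix.det_mul, Matrix.det_neg, hB, mul_comm, Fintype.card_coe] at hdet
  have h1 := mul_right_cancel₀ χ.lap_det_ne_zero hdet
  rw [← h1, ← Matrix.det_transpose, Matrix.transpose_add, Matrix.transpose_one]

/-- The scaling factors are rational functions of the rescaled variables. -/
theorem h_mem (F : Subfield K) (hF : ∀ j, χ.tilde j ∈ F) (i : V) : χ.h i ∈ F := by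
  have hr : ∀ k, (∑ j, if b j = k then x j else 0) ∈ F := by
    intro k
    rw [← χ.sum_tilde]
    refine sum_mem fun j _ => ?_
    split_ifs
    exacts [hF j, zero_mem F]
  have hX : ∀ i k, (∑ j, if b j = i ∧ b' j = k then χ.tilde j else 0) ∈ F := by
    intro i k
    refine sum_mem fun j _ => ?_
    split_ifs
    exacts [hF j, zero_mem F]
  have hent : ∀ k i, χ.lap k i ∈ F := by
    intro k i
    simp only [lap, Matrix.of_apply]
    refine sub_mem (hX _ _) ?_
    split_ifs
    exacts [hr _, zero_mem F]
  let A : Matrix χ.ν χ.ν F := Matrix.of fun k i => ⟨χ.lap i k, hent i k⟩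
  have hA : A.map F.subtype = χ.lap.transpose := rfl
  have hdet : A.det ≠ 0 := by
    intro h0
    have := F.subtype.map_det A
    rw [h0, map_zero, RingHom.mapMatrix_apply, hA, Matrix.det_transpose] at this
    exact χ.lap_det_ne_zero this.symm
  let rhs : χ.ν → F := fun i => -∑ k ∈ χ.νᶜ,
    (⟨∑ j, if b j = i ∧ b' j = k then χ.tilde j else 0, hX i k⟩ : F)
  have hsol : χ.lap.transpose.mulVec (fun k : χ.ν => χ.h k) = fun i => (rhs i : K) := by
    funext i
    -- Since `x̃_j h_{b' j} = x_j h_{b j}`, summing over the block `b j = i` gives a linear system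
    -- for `h` whose coefficients lie in `F`: the block sums of `x` are block sums of `x̃`. Its
    -- matrix on `ν` is the transpose of `χ.lap`, and the roots supply the inhomogeneous term.
    have h1 : ∑ k, (∑ j, if b j = i ∧ b' j = k then χ.tilde j else 0) * χ.h k =
        (∑ j, if b j = i then x j else 0) * χ.h i := by
      simp_rw [Finset.sum_mul]
      rw [Finset.sum_comm]
      refine Finset.sum_congr rfl fun j _ => ?_
      by_cases hj : b j = i
      · have := χ.h_ne_zero (b' j)
        simp only [hj, true_and, if_true, ite_mul, zero_mul, Finset.sum_ite_eq, Finset.mem_univ,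
          tilde]
        field_simp
      · simp [hj]
    have h2 : ∑ k ∈ χ.νᶜ, (∑ j, if b j = i ∧ b' j = k then χ.tilde j else 0) * χ.h k =
        ∑ k ∈ χ.νᶜ, (∑ j, if b j = i ∧ b' j = k then χ.tilde j else 0) :=
      Finset.sum_congr rfl fun k hk => by
        rw [χ.h_eq_one k (Finset.mem_compl.1 hk), mul_one]
    rw [← Finset.sum_add_sum_compl χ.ν, h2] at h1
    simp only [Matrix.mulVec, dotProduct, Matrix.transpose_apply, lap, Matrix.of_apply, sub_mul,
      Finset.sum_sub_distrib, ite_mul, zero_mul, Finset.sum_ite_eq', Finset.mem_univ, if_true, rhs]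
    rw [Finset.sum_coe_sort χ.ν fun k : V =>
      (∑ j, if b j = i ∧ b' j = k then χ.tilde j else 0) * χ.h k]
    push_cast
    rw [← h1]
    ring
  by_cases hi : i ∈ χ.ν
  · let s : χ.ν → F := A⁻¹.mulVec rhs
    have hs : A.mulVec s = rhs := by
      rw [Matrix.mulVec_mulVec, Matrix.mul_nonsing_inv _ hdet.isUnit, Matrix.one_mulVec]
    have hs' : χ.lap.transpose.mulVec (fun k => (s k : K)) = fun i => (rhs i : K) := by
      rw [← hA, ← hs]
      funext i
      exact (F.subtype.map_mulVec A s i).symm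
    have hinj := Matrix.mulVec_injective_iff_isUnit (A := χ.lap.transpose) |>.2
      ((Matrix.isUnit_iff_isUnit_det _).2
        (by rw [Matrix.det_transpose]; exact χ.lap_det_ne_zero.isUnit))
    have := congrFun (hinj (hsol.trans hs'.symm)) ⟨i, hi⟩
    simp only at this
    rw [this]
    exact (s _).2
  · rw [χ.h_eq_one i hi]
    exact one_mem F

theorem mem_of_tilde_mem (F : Subfield K) (hF : ∀ j, χ.tilde j ∈ F) (j : ι) : x j ∈ F := by
  have h1 := χ.h_ne_zero (b j)
  have h2 := χ.h_ne_zero (b' j)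
  have : x j = χ.tilde j * χ.h (b' j) / χ.h (b j) := by
    rw [tilde]
    field_simp
  rw [this]
  exact div_mem (mul_mem (hF j) (χ.h_mem F hF _)) (χ.h_mem F hF _)

end Exchange

end

end

noncomputable section

/-! ### The coordinates of the Przyjalkowski method -/

namespace PrzyjalkowskiChoice

variable {n R c : ℕ} {Y : SmoothCompleteFan n R} {L : Fin c → Y.Pic} {P P' : NefPartition Y L}
  (d : PrzyjalkowskiChoice P) {K : Type} [Field K]

/-- The quotients `x_j / x_{s_i}` for `j ∈ S_i`, `i ≤ c`, and `x_j` for `j ∈ S_{c+1}`. -/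
def quot (x : Fin R → K) (j : Fin R) : K :=
  x j / (Fin.snoc (α := fun _ => K) (fun i => x (d.s i)) 1 : Fin (c + 1) → K) (P.blk j)

theorem quot_cast (x : Fin R → K) {j : Fin R} {i : Fin c} (hj : P.blk j = i.castSucc) :
    d.quot x j = x j / x (d.s i) := by
  rw [quot, hj, Fin.snoc_castSucc]

theorem quot_last (x : Fin R → K) {j : Fin R} (hj : P.blk j = Fin.last c) :
    d.quot x j = x j := by
  rw [quot, hj, Fin.snoc_last, div_one]

theorem quot_ne_zero {x : Fin R → K} (hx : ∀ j, x j ≠ 0) (j : Fin R) : d.quot x j ≠ 0 := by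
  induction h : P.blk j using Fin.lastCases with
  | last => rw [d.quot_last x h]; exact hx j
  | cast i => rw [d.quot_cast x h]; exact div_ne_zero (hx _) (hx _)

theorem quot_s {x : Fin R → K} (hx : ∀ j, x j ≠ 0) (i : Fin c) : d.quot x (d.s i) = 1 := by
  rw [d.quot_cast x (d.blk_s i), div_self (hx _)]

/-- This recovers the denominators `x_{s_i}`, and with them the point, from the quotients. -/
theorem sum_quot {x : Fin R → K} {i : Fin c} (h : ∑ j ∈ P.S i.castSucc, x j = 1) :
    ∑ j ∈ P.S i.castSucc, d.quot x j = (x (d.s i))⁻¹ := by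
  rw [Finset.sum_congr rfl fun j hj => d.quot_cast x ((P.mem_S_iff _ _).1 hj), ← Finset.sum_div, h,
    one_div]

theorem notMem_E_of_mem {i : Fin c} {j : Fin R} (hj : j ∈ P.S i.castSucc) : j ∉ d.E := fun h =>
  (Fin.castSucc_lt_last i).ne (((P.mem_S_iff _ _).1 hj).symm.trans (d.blk_of_mem_E h))

theorem y_s (i : Fin c) : d.y (d.s i) = 1 := by
  rw [y, dif_neg]
  exact fun h => h.2 i rfl

theorem y_var (j : d.Var) : d.y j = torusCoord j := by
  rw [y, dif_pos j.2]

variable {d}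

theorem IsSubstitution.isDualPoint {x : Fin R → TorusFunctionField d.Var}
    (hx : d.IsSubstitution x) : Y.IsDualPoint x := ⟨hx.ne_zero, hx.relation⟩

theorem IsSubstitution.sum_eq_one {x : Fin R → TorusFunctionField d.Var}
    (hx : d.IsSubstitution x) (i : Fin c) : ∑ j ∈ P.S i.castSucc, x j = 1 := by
  rw [Finset.sum_congr rfl (hx.block i), ← Finset.sum_div]
  exact div_self (d.sum_y_ne_zero _ ⟨_, d.s_mem i⟩)

theorem IsSubstitution.quot_eq_y {x : Fin R → TorusFunctionField d.Var}
    (hx : d.IsSubstitution x) {j : Fin R} (hj : j ∉ d.E) : d.quot x j = d.y j := by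
  induction h : P.blk j using Fin.lastCases with
  | last => rw [d.quot_last x h, hx.free j ((P.mem_S_iff _ _).2 h) hj]
  | cast i =>
    rw [d.quot_cast x h, hx.block i j ((P.mem_S_iff _ _).2 h), hx.block i _ (d.s_mem i), d.y_s]
    have := d.sum_y_ne_zero (P.S i.castSucc) ⟨_, d.s_mem i⟩
    field_simp

/-- The formulas of the substitution are free of subtraction: fractions of sums of coordinates
outside `E`, and monomials in these for the rays of `E`. -/
theorem IsSubstitution.mem_positiveSystem {x : Fin R → TorusFunctionField d.Var}
    (hx : d.IsSubstitution x) (j : Fin R) :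
    x j ∈ (TorusFunctionField.positiveSystem d.Var).carrier := by
  set C := TorusFunctionField.positiveSystem d.Var
  have hy : ∀ j, d.y j ∈ C.carrier := by
    intro j
    rw [y]
    split_ifs with h
    · exact TorusFunctionField.torusCoord_mem_positiveSystem _
    · exact C.one_mem
  have hn : ∀ j ∉ d.E, x j ∈ C.carrier := by
    intro j hj
    induction h : P.blk j using Fin.lastCases with
    | last =>
      rw [hx.free j ((P.mem_S_iff _ _).2 h) hj]
      exact hy j
    | cast i =>
      rw [hx.block i j ((P.mem_S_iff _ _).2 h)]
      exact C.div_mem (hy j) (C.sum_mem _ _ (fun k _ => Or.inr (hy k)) (d.s_mem i)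
        (d.y_ne_zero _))
  by_cases hj : j ∈ d.E
  · obtain ⟨l, hl⟩ := d.exists_eq_prod hj
    rw [hl x hx.isDualPoint]
    exact C.prod_mem _ _ fun k hk => C.zpow_mem (hn k (Finset.mem_compl.1 hk)) _
  · exact hn j hj

variable (d)

/-- A field that contains the coordinates `d.quot x` contains all `x_j`. -/
theorem mem_of_quot_mem {x : Fin R → K} (hx : Y.IsDualPoint x)
    (hsum : ∀ i : Fin c, ∑ j ∈ P.S i.castSucc, x j = 1) (F : Subfield K)
    (hF : ∀ j : d.Var, d.quot x j ∈ F) (j : Fin R) : x j ∈ F := by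
  have hq : ∀ j ∉ d.E, d.quot x j ∈ F := by
    intro j hj
    obtain ⟨k | i, rfl⟩ := d.exists_freeRay hj
    · exact hF k
    · change d.quot x (d.s i) ∈ F
      rw [d.quot_s hx.ne_zero]
      exact one_mem F
  have hs : ∀ i, x (d.s i) ∈ F := by
    intro i
    rw [← inv_inv (x (d.s i)), ← d.sum_quot (hsum i)]
    exact inv_mem (sum_mem fun j hj => hq j (d.notMem_E_of_mem hj))
  have hn : ∀ j ∉ d.E, x j ∈ F := by
    intro j hj
    have h1 := hq j hj
    induction h : P.blk j using Fin.lastCases with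
    | last => rwa [d.quot_last x h] at h1
    | cast i =>
      rw [d.quot_cast x h] at h1
      have := mul_mem h1 (hs i)
      rwa [div_mul_cancel₀ _ (hx.ne_zero _)] at this
  by_cases hj : j ∈ d.E
  · obtain ⟨l, hl⟩ := d.exists_eq_prod hj
    rw [hl x hx]
    exact prod_mem fun k hk => zpow_mem (hn k (Finset.mem_compl.1 hk)) _
  · exact hn j hj

/-- A homomorphism that maps the variables to the coordinates of a point of the dual torus maps
the substitution to that point. -/
theorem map_substitution_eq {d : PrzyjalkowskiChoice P} {x : Fin R → TorusFunctionField d.Var}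
    (hx : d.IsSubstitution x) {z : Fin R → K} (hz : Y.IsDualPoint z)
    (hsum : ∀ i : Fin c, ∑ j ∈ P.S i.castSucc, z j = 1) (ψ : TorusFunctionField d.Var →+* K)
    (hψ : ∀ j : d.Var, ψ (torusCoord j) = d.quot z j) (j : Fin R) : ψ (x j) = z j := by
  have hq : ∀ j ∉ d.E, ψ (d.y j) = d.quot z j := by
    intro j hj
    obtain ⟨k | i, rfl⟩ := d.exists_freeRay hj
    · exact (congrArg ψ (d.y_var k)).trans (hψ k)
    · change ψ (d.y (d.s i)) = d.quot z (d.s i)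
      rw [d.y_s, map_one, d.quot_s hz.ne_zero]
  have hn : ∀ j ∉ d.E, ψ (x j) = z j := by
    intro j hj
    induction h : P.blk j using Fin.lastCases with
    | last => rw [hx.free j ((P.mem_S_iff _ _).2 h) hj, hq j hj, d.quot_last z h]
    | cast i =>
      rw [hx.block i j ((P.mem_S_iff _ _).2 h), map_div₀, hq j hj, map_sum,
        Finset.sum_congr rfl fun k hk => hq k (d.notMem_E_of_mem hk), d.sum_quot (hsum i),
        d.quot_cast z h]
      have := hz.ne_zero (d.s i)
      field_simp
  by_cases hj : j ∈ d.E
  · obtain ⟨l, hl⟩ := d.exists_eq_prod hj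
    rw [hl x hx.isDualPoint, hl z hz, map_prod]
    refine Finset.prod_congr rfl fun k hk => ?_
    rw [map_zpow₀, hn k (Finset.mem_compl.1 hk)]
  · exact hn j hj

/-- The vectors of `N` that correspond to the coordinates `d.quot x`. -/
def quotRay (K : Type) [Field K] (j : Fin R) : Fin n → K :=
  Y.rayOver K j - ∑ i : Fin c, if P.blk j = i.castSucc then Y.rayOver K (d.s i) else 0

theorem map_quotRay [Algebra ℂ K] {x : Fin R → K} (hx : ∀ j, x j ≠ 0)
    (π : (Fin n → K) →ₗ[K] Ω[K⁄ℂ]) (hπ : ∀ j, π (Y.rayOver K j) = dlog (x j)) (j : Fin R) :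
    π (d.quotRay K j) = dlog (d.quot x j) := by
  rw [quotRay, map_sub, hπ]
  induction h : P.blk j using Fin.lastCases with
  | last =>
    rw [d.quot_last x h, Finset.sum_eq_zero fun i _ => if_neg (Fin.castSucc_lt_last i).ne',
      map_zero, sub_zero]
  | cast i =>
    simp only [Fin.castSucc_inj, Finset.sum_ite_eq, Finset.mem_univ, if_true]
    rw [d.quot_cast x h, hπ, dlog_div (hx _) (hx _)]

/-- The rays of `E` all lie in the last block, so any other block consists of `s_i` and variables.
-/
theorem sum_block {W : Type*} [AddCommGroup W] {m : ℕ} (e : Fin m ≃ d.Var) (f : Fin R → W)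
    (i : Fin c) : ∑ j, (if P.blk j = i.castSucc then f j else 0) =
      f (d.s i) + ∑ k, if P.blk (e k) = i.castSucc then f (e k) else 0 := by
  rw [← Fintype.sum_of_injective d.freeRay d.freeRay_injective
    (fun k => if P.blk (d.freeRay k) = i.castSucc then f (d.freeRay k) else 0) _ ?_ fun _ => rfl,
    Fintype.sum_sum_type, add_comm, ← e.sum_comp]
  · congr 1
    simp [freeRay, d.blk_s]
  · intro j hj
    have : j ∈ d.E := by
      by_contra h
      obtain ⟨k, hk⟩ := d.exists_freeRay h
      exact hj ⟨k, hk⟩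
    rw [d.blk_of_mem_E this, if_neg (Fin.castSucc_lt_last i).ne']

/-- The second half of the family lifts the differentials of the block sums. As these sums are `1`,
its members are affine combinations of the rays of a block, and the determinant reduces to that of
the rays outside `E`. -/
theorem det_quotRay {m : ℕ} (e : Fin m ≃ d.Var) (τ : Fin n ≃ Fin m ⊕ Fin c) {x : Fin R → K}
    (hsum : ∀ i : Fin c, ∑ j ∈ P.S i.castSucc, x j = 1) :
    ((Pi.basisFun K (Fin n)).reindex τ).det (Sum.elim (fun k => d.quotRay K (e k)) fun i =>
        ∑ j, if P.blk j = i.castSucc then x j • Y.rayOver K j else 0) = 1 ∨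
      ((Pi.basisFun K (Fin n)).reindex τ).det (Sum.elim (fun k => d.quotRay K (e k)) fun i =>
        ∑ j, if P.blk j = i.castSucc then x j • Y.rayOver K j else 0) = -1 := by
  have h := AlternatingMap.map_differences_barycenters ((Pi.basisFun K (Fin n)).reindex τ).det
    (fun k => Y.rayOver K (e k)) (fun i => Y.rayOver K (d.s i))
    (fun k i => P.blk (e k) = i.castSucc)
    (fun k i i' h1 h2 => Fin.castSucc_injective _ (h1.symm.trans h2))
    (fun k => x (e k)) (fun i => x (d.s i)) (fun i => by
      rw [← d.sum_block e, ← hsum i, P.S_eq_filter, Finset.sum_filter])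
  simp_rw [d.sum_block e (fun j => x j • Y.rayOver K j)]
  rw [show (fun k => d.quotRay K (e k)) = fun k => Y.rayOver K (e k) - ∑ i : Fin c,
    if P.blk (e k) = i.castSucc then Y.rayOver K (d.s i) else 0 from rfl, h]
  exact d.det_rayOver K e τ

end PrzyjalkowskiChoice

/-! ### The birational map between two mirrors -/

namespace NefPartition

variable {n R c : ℕ} {Y : SmoothCompleteFan n R} {L : Fin c → Y.Pic} {P P' : NefPartition Y L}
  {K : Type} [Field K] {x : Fin R → K}

/-- In the monomial of a relation `l`, the factor `h i` occurs with exponent `∑ l_j m_i(v_j)`, which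
is `m_i` applied to the relation and so zero. -/
theorem isDualPoint_tilde (hx : Y.IsDualPoint x) (χ : Exchange P.blk P'.blk x) :
    Y.IsDualPoint χ.tilde := by
  refine ⟨χ.tilde_ne_zero hx.ne_zero, fun l hl => ?_⟩
  have hexp : ∀ b : Fin R → Fin (c + 1), ∏ j, χ.h (b j) ^ l j =
      ∏ i, χ.h i ^ ∑ j, if b j = i then l j else 0 := by
    intro b
    have h1 : ∀ i, χ.h i ^ (∑ j, if b j = i then l j else 0) =
        ∏ j, if b j = i then χ.h i ^ l j else 1 := by
      intro i
      have : ∀ T : Finset (Fin R), χ.h i ^ (∑ j ∈ T, if b j = i then l j else 0) =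
          ∏ j ∈ T, if b j = i then χ.h i ^ l j else 1 := by
        intro T
        induction T using Finset.induction_on with
        | empty => simp
        | insert a T ha ih =>
          rw [Finset.sum_insert ha, Finset.prod_insert ha, zpow_add₀ (χ.h_ne_zero i), ih]
          congr 1
          split_ifs <;> simp
      exact this _
    simp_rw [h1]
    rw [Finset.prod_comm]
    simp
  have heq : ∀ i, (∑ j, if P.blk j = i then l j else 0) = ∑ j, if P'.blk j = i then l j else 0 := by
    intro i
    obtain ⟨m, hm⟩ := P.exists_dual_blk P' i
    have h1 := congrArg m hl
    simp only [map_sum, map_smul, map_zero, hm, smul_eq_mul, mul_sub, mul_ite, mul_one, mul_zero,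
      Finset.sum_sub_distrib, sub_eq_zero] at h1
    exact h1
  have h2 : ∏ j, χ.h (P.blk j) ^ l j = ∏ j, χ.h (P'.blk j) ^ l j := by
    rw [hexp, hexp]
    exact Finset.prod_congr rfl fun i _ => by rw [heq]
  simp only [Exchange.tilde, div_zpow, mul_zpow, Finset.prod_div_distrib, Finset.prod_mul_distrib,
    hx.relation l hl, h2, one_mul]
  exact div_self (Finset.prod_ne_zero_iff.2 fun j _ => zpow_ne_zero _ (χ.h_ne_zero _))

theorem sum_tilde_eq_one (hsum : ∀ i : Fin c, ∑ j ∈ P.S i.castSucc, x j = 1)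
    (χ : Exchange P.blk P'.blk x) (i : Fin c) : ∑ j ∈ P'.S i.castSucc, χ.tilde j = 1 := by
  rw [P'.S_eq_filter, Finset.sum_filter, χ.sum_tilde, ← Finset.sum_filter, ← P.S_eq_filter, hsum]

theorem exists_functionals_over (P P' : NefPartition Y L) (K : Type) [Field K] :
    ∃ M : Matrix (Fin (c + 1)) (Fin n) K, ∀ i j, ∑ a, M i a * Y.rayOver K j a =
      (if P.blk j = i then 1 else 0) - (if P'.blk j = i then 1 else 0) := by
  choose m hm using P.exists_dual_blk P'
  refine ⟨Matrix.of fun i a => (m i (Pi.single a 1) : K), fun i j => ?_⟩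
  have h1 : m i (Y.ray j) = ∑ a, m i (Pi.single a 1) * Y.ray j a := by
    conv_lhs => rw [← Finset.univ_sum_single (Y.ray j)]
    rw [map_sum]
    refine Finset.sum_congr rfl fun a _ => ?_
    rw [mul_comm, ← smul_eq_mul, ← map_smul, ← Pi.single_smul, smul_eq_mul, mul_one]
  have h2 := congrArg (Int.cast : ℤ → K) (h1.symm.trans (hm i j))
  push_cast at h2
  exact h2

/-- The lift of the differential of the exchange to the cotangent space of the dual torus. -/
theorem exists_cotangent_lift [Algebra ℂ K] (hx : Y.IsDualPoint x) (χ : Exchange P.blk P'.blk x)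
    (π : (Fin n → K) →ₗ[K] Ω[K⁄ℂ]) (hπ : ∀ j, π (Y.rayOver K j) = dlog (x j)) :
    ∃ Φ : (Fin n → K) →ₗ[K] (Fin n → K), LinearMap.det Φ = (-1) ^ χ.ν.card ∧
      (∀ j, π (Φ (Y.rayOver K j)) = dlog (χ.tilde j)) ∧
      ∀ k, Φ (∑ j, if P'.blk j = k then χ.tilde j • Y.rayOver K j else 0) =
        ∑ j, if P.blk j = k then x j • Y.rayOver K j else 0 := by
  obtain ⟨η, hη, hηk⟩ := χ.exists_linearization (Y.rayOver K)
  obtain ⟨M, hM⟩ := P.exists_functionals_over P' K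
  let μ : Fin (c + 1) → (Fin n → K) →ₗ[K] K := fun i => ∑ a, M i a • LinearMap.proj a
  have hμ : ∀ i v, μ i v = ∑ a, M i a * v a := by
    intro i v
    simp [μ]
  have hdet := χ.det_linearization (Y.rayOver K) η hη hηk μ fun i j => by rw [hμ, hM]
  let H : Matrix (Fin n) χ.ν K := Matrix.of fun a i => η i a
  let N : Matrix χ.ν (Fin n) K := Matrix.of fun i a => M i a
  -- The map `v ↦ v + ∑ m_i(v) η_i` sends `v_j` to `v_j + η_{b j} - η_{b' j}`, which mimics the
  -- logarithmic derivative of `x̃_j`. Its determinant equals that of the smaller matrix `1 + N *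
  -- H`.
  let Φ := Matrix.toLin' (1 + H * N)
  have hΦ : ∀ v, Φ v = v + ∑ i : χ.ν, μ i v • η i := by
    intro v
    simp only [Φ, Matrix.toLin'_apply, Matrix.add_mulVec, Matrix.one_mulVec]
    rw [← Matrix.mulVec_mulVec]
    congr 1
    ext a
    simp only [Matrix.mulVec, dotProduct, H, N, Matrix.of_apply, Finset.sum_apply, Pi.smul_apply,
      smul_eq_mul, hμ]
    exact Finset.sum_congr rfl fun i _ => mul_comm _ _
  have hΦr : ∀ j, Φ (Y.rayOver K j) = Y.rayOver K j + η (P.blk j) - η (P'.blk j) := by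
    intro j
    rw [hΦ, add_sub_assoc]
    congr 1
    rw [Finset.sum_coe_sort χ.ν fun i => μ i (Y.rayOver K j) • η i,
      Finset.sum_subset (Finset.subset_univ χ.ν) fun i _ hi => by rw [hη i hi, smul_zero]]
    simp_rw [hμ, hM, sub_smul]
    rw [Finset.sum_sub_distrib]
    simp
  -- Both sides solve the system linearized at the logarithmic derivatives of `x`: the left one as
  -- an image under `π`, the right one by differentiating the equality of block sums.
  have hlog : ∀ i, π (η i) = dlog (χ.h i) := by
    refine χ.linearization_unique (fun j => dlog (x j)) (fun i => π (η i)) (fun i => dlog (χ.h i))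
      (fun i hi => by rw [hη i hi, map_zero])
      (fun i hi => by rw [χ.h_eq_one i hi, dlog_one]) (fun k => ?_) (fun k => ?_)
    · have h1 := congrArg π (hηk k)
      rw [map_sum, map_sum] at h1
      convert h1 using 1
      · refine Finset.sum_congr rfl fun j _ => ?_
        split_ifs
        · rw [map_smul, map_sub, map_add, hπ]
        · rw [map_zero]
      · refine Finset.sum_congr rfl fun j _ => ?_
        split_ifs
        · rw [map_smul, hπ]
        · rw [map_zero]
    · have h1 := congrArg (KaehlerDifferential.D ℂ K) (χ.sum_tilde k)
      rw [map_sum, map_sum] at h1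
      convert h1 using 1
      · refine Finset.sum_congr rfl fun j _ => ?_
        split_ifs with hj
        · rw [← smul_dlog (χ.tilde_ne_zero hx.ne_zero j), Exchange.tilde,
            dlog_div (mul_ne_zero (hx.ne_zero j) (χ.h_ne_zero _)) (χ.h_ne_zero _),
            dlog_mul (hx.ne_zero j) (χ.h_ne_zero _), hj]
        · rw [map_zero]
      · refine Finset.sum_congr rfl fun j _ => ?_
        split_ifs
        · rw [smul_dlog (hx.ne_zero j)]
        · rw [map_zero]
  refine ⟨Φ, ?_, fun j => ?_, fun k => ?_⟩
  · rw [LinearMap.det_toLin', Matrix.det_one_add_mul_comm, ← hdet]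
    congr 2
    ext l i
    simp [Matrix.mul_apply, H, N, hμ]
  · rw [hΦr, map_sub, map_add, hπ, hlog, hlog, Exchange.tilde,
      dlog_div (mul_ne_zero (hx.ne_zero j) (χ.h_ne_zero _)) (χ.h_ne_zero _),
      dlog_mul (hx.ne_zero j) (χ.h_ne_zero _)]
  · rw [← hηk k, map_sum]
    refine Finset.sum_congr rfl fun j _ => ?_
    split_ifs with hj
    · rw [map_smul, hΦr, hj]
    · rw [map_zero]

end NefPartition

/-! ### Volume preservation and the comparison of two mirrors -/

namespace PrzyjalkowskiChoice

variable {n R c : ℕ} {Y : SmoothCompleteFan n R} {L : Fin c → Y.Pic} {P P' : NefPartition Y L}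

/-- An exchange preserves the volume form, up to sign. -/
theorem wedge_dlog_exchange (d : PrzyjalkowskiChoice P) (d' : PrzyjalkowskiChoice P') {K : Type}
    [Field K] [Algebra ℂ K] {x : Fin R → K} (hx : Y.IsDualPoint x)
    (hsum : ∀ i : Fin c, ∑ j ∈ P.S i.castSucc, x j = 1) (χ : Exchange P.blk P'.blk x) {m : ℕ}
    (e : Fin m ≃ d.Var) (e' : Fin m ≃ d'.Var) :
    exteriorPower.ιMulti K m (fun k => dlog (d'.quot χ.tilde (e' k))) =
        exteriorPower.ιMulti K m (fun k => dlog (d.quot x (e k))) ∨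
      exteriorPower.ιMulti K m (fun k => dlog (d'.quot χ.tilde (e' k))) =
        -exteriorPower.ιMulti K m (fun k => dlog (d.quot x (e k))) := by
  obtain ⟨π, hπ⟩ := hx.exists_dlog
  obtain ⟨Φ, hdet, hΦ, hΦκ⟩ := NefPartition.exists_cotangent_lift hx χ π hπ
  have hmc : n = m + c := by
    rw [← d.card_var_add, ← Nat.card_congr e, Nat.card_fin]
  let τ : Fin n ≃ Fin m ⊕ Fin c := (finCongr hmc).trans finSumFinEquiv.symm
  let b := (Pi.basisFun K (Fin n)).reindex τ
  let κ : Fin c → Fin n → K := fun i =>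
    ∑ j, if P.blk j = i.castSucc then x j • Y.rayOver K j else 0
  let κ' : Fin c → Fin n → K := fun i =>
    ∑ j, if P'.blk j = i.castSucc then χ.tilde j • Y.rayOver K j else 0
  have hu : b.det (Sum.elim (fun k => d.quotRay K (e k)) κ) = 1 ∨
      b.det (Sum.elim (fun k => d.quotRay K (e k)) κ) = -1 := d.det_quotRay e τ hsum
  have hu' : b.det (Sum.elim (fun k => d'.quotRay K (e' k)) κ') = 1 ∨
      b.det (Sum.elim (fun k => d'.quotRay K (e' k)) κ') = -1 :=
    d'.det_quotRay e' τ (NefPartition.sum_tilde_eq_one hsum χ)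
  -- As `Φ` takes `κ'` to `κ`, this family is the image of the one in `hu'`, and `Φ` has determinant
  -- `±1`.
  have hw : b.det (Sum.elim (fun k => Φ (d'.quotRay K (e' k))) κ) = 1 ∨
      b.det (Sum.elim (fun k => Φ (d'.quotRay K (e' k))) κ) = -1 := by
    have h1 : Sum.elim (fun k => Φ (d'.quotRay K (e' k))) κ =
        Φ ∘ Sum.elim (fun k => d'.quotRay K (e' k)) κ' := by
      funext k
      rcases k with k | i
      · rfl
      · exact (hΦκ i.castSucc).symm
    rw [h1, Module.Basis.det_comp, hdet]
    rcases neg_one_pow_eq_or K χ.ν.card with h | h <;> rcases hu' with h' | h' <;>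
      rw [h, h'] <;> simp
  -- The image of `κ i` is the differential of a block sum, which is the constant `1`.
  have hκ : ∀ i, π (κ i) = 0 := by
    intro i
    have h1 := congrArg (KaehlerDifferential.D ℂ K) (hsum i)
    rw [Derivation.map_one_eq_zero, map_sum, P.S_eq_filter, Finset.sum_filter] at h1
    rw [← h1, map_sum]
    refine Finset.sum_congr rfl fun j _ => ?_
    split_ifs
    · rw [map_smul, hπ, smul_dlog (hx.ne_zero j)]
    · rw [map_zero]
  have hu0 : b.det (Sum.elim (fun k => d.quotRay K (e k)) κ) ≠ 0 := by
    rcases hu with h | h <;> rw [h] <;> simp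
  have key := AlternatingMap.det_smul_map_quotient b
    (exteriorPower.ιMulti K m (M := Ω[K⁄ℂ])) π (fun k => d.quotRay K (e k))
    (fun k => Φ (d'.quotRay K (e' k))) κ hκ hu0
  have hl : (fun k => π (d.quotRay K (e k))) = fun k => dlog (d.quot x (e k)) :=
    funext fun k => d.map_quotRay hx.ne_zero π hπ _
  have hl' : (fun k => π (Φ (d'.quotRay K (e' k)))) = fun k => dlog (d'.quot χ.tilde (e' k)) :=
    funext fun k => d'.map_quotRay (χ.tilde_ne_zero hx.ne_zero) (π ∘ₗ Φ) hΦ (e' k)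
  rw [hl, hl'] at key
  rcases hu with h | h <;> rcases hw with h' | h' <;> rw [h, h'] at key <;>
    simp only [neg_smul, one_smul, neg_inj] at key
  · exact Or.inl key
  · exact Or.inr key
  · exact Or.inr (neg_eq_iff_eq_neg.1 key)
  · exact Or.inl key

theorem isVolumePreserving_of_exchange {d : PrzyjalkowskiChoice P} (d' : PrzyjalkowskiChoice P')
    {x : Fin R → TorusFunctionField d.Var} (hx : d.IsSubstitution x)
    (χ : Exchange P.blk P'.blk x) (ψ : TorusFunctionField d'.Var ≃ₐ[ℂ] TorusFunctionField d.Var)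
    (hψ : ∀ j : d'.Var, ψ (torusCoord j) = d'.quot χ.tilde j) : IsVolumePreserving ψ := by
  have hc : Nat.card d.Var = Nat.card d'.Var :=
    Nat.add_right_cancel (d.card_var_add.trans d'.card_var_add.symm)
  let e : Fin (Nat.card d.Var) ≃ d.Var := (Finite.equivFin d.Var).symm
  let e' : Fin (Nat.card d.Var) ≃ d'.Var := (finCongr hc).trans (Finite.equivFin d'.Var).symm
  refine ⟨Nat.card d.Var, e', e, ?_⟩
  have h1 : (fun k => ψ (torusCoord (e' k))) = fun k => d'.quot χ.tilde (e' k) :=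
    funext fun k => hψ _
  have h2 : (fun k => torusCoord (e k)) = fun k => d.quot x (e k) :=
    funext fun k => by rw [hx.quot_eq_y (e k).2.1, d.y_var]
  rw [h1, h2]
  exact wedge_dlog_exchange d d' hx.isDualPoint hx.sum_eq_one χ e e'

/-- The coordinates of the second mirror are evaluated at the exchanged point. They generate the
function field, since they determine `x̃`, which determines `x`; by the equality of dimensions they
are coordinates of a birational map. It carries `x'` to `x̃`, whose sum is that of `x`. -/
theorem exists_algEquiv_of_substitutions {d : PrzyjalkowskiChoice P} {d' : PrzyjalkowskiChoice P'}
    {x : Fin R → TorusFunctionField d.Var} (hx : d.IsSubstitution x)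
    {x' : Fin R → TorusFunctionField d'.Var} (hx' : d'.IsSubstitution x') :
    ∃ ψ : TorusFunctionField d'.Var ≃ₐ[ℂ] TorusFunctionField d.Var,
      IsVolumePreserving ψ ∧ ψ (∑ j, x' j) = ∑ j, x j := by
  obtain ⟨χ⟩ := Exchange.nonempty (TorusFunctionField.positiveSystem d.Var)
    hx.mem_positiveSystem (P.blk_mem_of_forall P')
  have hz := NefPartition.isDualPoint_tilde hx.isDualPoint χ
  have hsum := NefPartition.sum_tilde_eq_one hx.sum_eq_one χ
  have hc : Nat.card d.Var = Nat.card d'.Var :=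
    Nat.add_right_cancel (d.card_var_add.trans d'.card_var_add.symm)
  have htop : IntermediateField.adjoin ℂ (Set.range fun j : d'.Var => d'.quot χ.tilde j) = ⊤ := by
    set F := IntermediateField.adjoin ℂ (Set.range fun j : d'.Var => d'.quot χ.tilde j)
    have hxF : ∀ j, x j ∈ F.toSubfield := χ.mem_of_tilde_mem _
      (d'.mem_of_quot_mem hz hsum _ fun j => IntermediateField.subset_adjoin _ _ ⟨j, rfl⟩)
    refine TorusFunctionField.eq_top_of_torusCoord_mem F fun j => ?_
    rw [← d.y_var, ← hx.quot_eq_y j.2.1]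
    induction h : P.blk j using Fin.lastCases with
    | last => rw [d.quot_last x h]; exact hxF j
    | cast i => rw [d.quot_cast x h]; exact div_mem (hxF j) (hxF (d.s i))
  obtain ⟨ψ, hψ⟩ := TorusFunctionField.exists_algEquiv hc (fun j : d'.Var => d'.quot χ.tilde j)
    (fun j => d'.quot_ne_zero hz.ne_zero j) htop
  refine ⟨ψ, isVolumePreserving_of_exchange d' hx χ ψ hψ, ?_⟩
  rw [map_sum, ← χ.sum_tilde_univ]
  exact Finset.sum_congr rfl fun j _ =>
    map_substitution_eq hx' hz hsum (ψ : TorusFunctionField d'.Var →+* TorusFunctionField d.Var)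
      hψ j

end PrzyjalkowskiChoice

end

theorem corollary2 {n R c : ℕ} (Y : SmoothCompleteFan n R) (hY : Y.IsAmple Y.antiK)
    (L : Fin c → Y.Pic) (hL : ∀ i, Y.IsNef (L i)) (hΛ : Y.IsAmple (Y.antiK - ∑ i, L i))
    (P P' : NefPartition Y L) (d : PrzyjalkowskiChoice P) (d' : PrzyjalkowskiChoice P')
    (f : LaurentRing d.Var) (g : LaurentRing d'.Var) (hf : d.IsMirror f) (hg : d'.IsMirror g) :
    MutationEquivalent f g := by
  obtain ⟨x, hx, hfx⟩ := hf
  obtain ⟨x', hx', hgx⟩ := hg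
  -- The exchange is performed on the torus of `g`, so that `ψ` maps the function field of the torus
  -- of `f` to that of `g`.
  obtain ⟨ψ, hvol, hψ⟩ := PrzyjalkowskiChoice.exists_algEquiv_of_substitutions hx' hx
  exact ⟨ψ, hvol, by rw [hfx, hgx, hψ]⟩
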